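/- Let $N\ge 1$ and let $0\le k<r$ be integers; put $q=e^{2\pi i z}$, $y=\operatorname{Im} z$ and $m=r-k-1$. Let $f=\sum_{n\ge1}a(n)q^n$ be a cusp form of weight $2k+1$ and $g=\sum_{n\ge0}b(n)q^n$ a holomorphic modular form of weight $1$, both on $\Gamma_1(N)$ (for example, forms on $\Gamma_0(N)$ with nebentypus). For a smooth function $F$ on the upper half plane let $\delta_w F=\frac1{2\pi i}\left(\frac{\partial F}{\partial z}+\frac{w}{2iy}F\right)$, where $\frac{\partial}{\partial z}=\frac12\left(\frac{\partial}{\partial x}-i\frac{\partial}{\partial y}\right)$, and let $\delta_1^m=\delta_{2m-1}\circ\cdots\circ\delta_3\circ\delta_1$. If $F$ transforms like a modular form of weight $2r$ on $\Gamma_1(N)$, its holomorphic projection $H(F)$ is the cusp form in $S_{2r}(\Gamma_1(N))$ such that for all $\varphi\in S_{2r}(\Gamma_1(N))$ $$\int_{\Gamma_1(N)\backslash\mathcal H}\overline{\varphi}\,H(F)\,y^{2r}\,\frac{dx\,dy}{y^2}=\int_{\Gamma_1(N)\backslash\mathcal H}\overline{\varphi}\,F\,y^{2r}\,\frac{dx\,dy}{y^2},$$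 where the integrals on the right are required to converge absolutely. Then $F=f\,\delta_1^{r-k-1}(g)$ transforms with weight $2r$ on $\Gamma_1(N)$, its holomorphic projection exists and is unique, and $H(f\,\delta_1^{r-k-1}(g))=\sum_{n\ge1}c(n)q^n$ with $$c(n)=\frac{(-1)^{r-k-1}}{\binom{2r-2}{r-k-1}}\,n^{r-k-1}\sum_{i+j=n}a(i)b(j)\,H_{r-k-1,k}\!\left(\frac{i-j}{i+j}\right),$$ where the sum is over $i\ge1$, $j\ge0$, and $$H_{m,k}(t)=\frac{1}{2^m\,(m+2k)!}\left(\frac{d}{dt}\right)^{m+2k}\left[(t^2-1)^m(t-1)^{2k}\right].$$ Moreover, if $f$ and $g$ are forms on $\Gamma_0(N)$ with nebentypus characters $\chi$ and $\psi$ modulo $N$, then $H(f\,\delta_1^{r-k-1}(g))$ is a form on $\Gamma_0(N)$ with nebentypus $\chi\psi$. -/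

import Mathlib

open scoped UpperHalfPlane MatrixGroups ModularForm Modular

noncomputable section

namespace HolProj

/-- The Wirtinger derivative `∂F/∂z = (1/2) (∂/∂x - i ∂/∂y) F` of a (real differentiable, not
necessarily holomorphic) function on the upper half plane. -/
def wirtinger (F : ℍ → ℂ) (τ : ℍ) : ℂ :=
  (1 / 2) * (fderiv ℝ (F ∘ UpperHalfPlane.ofComplex) (τ : ℂ) 1 -
    Complex.I * fderiv ℝ (F ∘ UpperHalfPlane.ofComplex) (τ : ℂ) Complex.I)

/-- Shimura's (Maass-Shimura) differential operator in weight `w`: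
`δ_w F = (1 / 2πi) (∂F/∂z + (w / 2iy) F)`, raising the weight by two. -/
def shimura (w : ℤ) (F : ℍ → ℂ) (τ : ℍ) : ℂ :=
  (1 / (2 * Real.pi * Complex.I)) *
    (wirtinger F τ + (w : ℂ) / (2 * Complex.I * (τ.im : ℂ)) * F τ)

/-- The iterate `δ_w^m = δ_{w+2m-2} ∘ ⋯ ∘ δ_{w+2} ∘ δ_w`. -/
def shimuraIter (w : ℤ) : ℕ → (ℍ → ℂ) → ℍ → ℂ
  | 0, F => F
  | m + 1, F => shimura (w + 2 * m) (shimuraIter w m F)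

/-- The (unnormalised) Petersson pairing `∫_{Γ \ ℍ} conj φ(τ) F(τ) y^w dx dy / y^2` for
`Γ = Γ_1(N)`, computed over the union of the translates `γ⁻¹ 𝒟` of the standard fundamental domain
`𝒟` of `SL(2, ℤ)`, where `γ` runs over representatives of `SL(2, ℤ) / Γ` (if `-1 ∉ Γ` these
translates cover `Γ \ ℍ` twice, which doubles the pairing and is harmless).  The measure on `ℍ` is
the invariant one, and `UpperHalfPlane.petersson w φ F` is `τ ↦ conj φ(τ) F(τ) y^w`. -/
def peterssonPairing (N : ℕ) (w : ℤ) (φ F : ℍ → ℂ) : ℂ :=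
  ∑ᶠ c : SL(2, ℤ) ⧸ CongruenceSubgroup.Gamma1 N,
    ∫ τ in 𝒟, UpperHalfPlane.petersson w φ F ((Quotient.out c)⁻¹ • τ)

/-- `h` is a holomorphic projection of `F`: the function `F` (in general not holomorphic) transforms
like a modular form of weight `w` on `Γ_1(N)`, its Petersson pairing with every cusp form converges
absolutely, and the cusp form `h` represents this pairing, `⟨φ, h⟩ = ⟨φ, F⟩` for all cusp
forms `φ`. -/
structure IsHolomorphicProjection (N : ℕ) (w : ℤ) (F : ℍ → ℂ)
    (h : CuspForm (CongruenceSubgroup.Gamma1 N) w) : Prop where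
  slash_eq : ∀ γ ∈ CongruenceSubgroup.Gamma1 N, F ∣[w] γ = F
  integrable : ∀ (φ : CuspForm (CongruenceSubgroup.Gamma1 N) w) (γ : SL(2, ℤ)),
    MeasureTheory.IntegrableOn (fun τ : ℍ ↦ UpperHalfPlane.petersson w φ F (γ • τ)) 𝒟
  pairing_eq : ∀ φ : CuspForm (CongruenceSubgroup.Gamma1 N) w,
    peterssonPairing N w φ h = peterssonPairing N w φ F

/-- `F` has weight `w` on `Γ_0(N)` with nebentypus `χ`: `F ∣[w] γ = χ(d) F` for every
`γ = (a b; c d)` in `Γ_0(N)`. -/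
def HasNebentypus (N : ℕ) (w : ℤ) (χ : DirichletCharacter ℂ N) (F : ℍ → ℂ) : Prop :=
  ∀ γ ∈ CongruenceSubgroup.Gamma0 N, F ∣[w] γ = χ ((γ 1 1 : ℤ) : ZMod N) • F

/-- `H_{m,k}(t) = 1 / (2^m (m+2k)!) (d/dt)^{m+2k} [(t^2 - 1)^m (t - 1)^{2k}]`. -/
def jacobiH (m k : ℕ) (t : ℝ) : ℝ :=
  1 / (2 ^ m * (Nat.factorial (m + 2 * k) : ℝ)) *
    iteratedDeriv (m + 2 * k) (fun x : ℝ ↦ (x ^ 2 - 1) ^ m * (x - 1) ^ (2 * k)) t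

end HolProj

end

noncomputable section

namespace HolProj

open UpperHalfPlane hiding I
open Complex Filter Topology MeasureTheory
open CongruenceSubgroup
open scoped Manifold ContDiff ComplexConjugate Derivative

/-! ### Smooth functions on the upper half plane -/

/-! The projection is a multiple of the `m`-th Rankin-Cohen bracket of `f` and `g`, in weights `p +
1 = 2k + 1` and `q + 1 = 1`, where `m = r - k - 1`. Put `X = -1/(4πy)` and `D = (1/2πi) d/dz`. Then
`δ_w = D + wX` and `DX = -X²`, so `δ_w^n F` is a polynomial in `X` with holomorphic coefficients and
constant term `D^n F`. The bracket coefficients are such that replacing each `D` by `δ` gives a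
polynomial in `X` with zero derivative, hence the bracket again (`rankinCohen_eq_shimura`). Since
`δ` is equivariant under slashing (`shimura_slash`), the bracket, visibly holomorphic, is modular,
and it is a cusp form because `f` is.

By Stokes' theorem on the fundamental domain, a cusp form is orthogonal to every suitable `δ_v G`
(`peterssonPairing_shimura_eq_zero`). With the Leibniz rule this moves derivatives: under the
pairing, `δ^a f · δ^b g` equals `(-1)^a f · δ^(a+b) g`. The signs cancel those of the bracket, and
Vandermonde's identity leaves `binom(2r-2, m)` times `f · δ^m g` (`peterssonPairing_rankinCohen`).
Uniqueness is positive definiteness of the Petersson product on cusp forms.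

On `q`-expansions `D` multiplies the `n`-th coefficient by `n`, so the pair `(i, j)` enters with
weight `∑ c_ab i^a j^b`. Leibniz' rule applied to the Rodrigues formula identifies this sum with
`(-1)^m (i+j)^m H_{m,k}((i-j)/(i+j))` (`sum_rankinCohenCoeff_eq_jacobiH`). -/

/-- `F` is smooth as a function of two real variables. -/
def RSmooth (F : ℍ → ℂ) : Prop := ContDiffOn ℝ ∞ (F ∘ ofComplex) {z | 0 < z.im}

lemma isOpen_im_pos : IsOpen {z : ℂ | 0 < z.im} := isOpen_lt continuous_const Complex.continuous_im

namespace RSmooth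

variable {F G : ℍ → ℂ}

lemma contDiffAt (hF : RSmooth F) (τ : ℍ) : ContDiffAt ℝ ∞ (F ∘ ofComplex) τ :=
  (hF τ τ.im_pos).contDiffAt (isOpen_im_pos.mem_nhds τ.im_pos)

lemma differentiableAt (hF : RSmooth F) (τ : ℍ) : DifferentiableAt ℝ (F ∘ ofComplex) τ :=
  (hF.contDiffAt τ).differentiableAt (by simp)

lemma continuous (hF : RSmooth F) : Continuous F := by
  rw [continuous_iff_continuousAt]
  intro τ
  have h := ((hF.contDiffAt τ).continuousAt).comp (f := UpperHalfPlane.coe)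
    (UpperHalfPlane.continuous_coe.continuousAt (x := τ))
  refine h.congr (Eventually.of_forall fun z ↦ ?_)
  simp [ofComplex_apply]

lemma add (hF : RSmooth F) (hG : RSmooth G) : RSmooth (F + G) := ContDiffOn.add hF hG

lemma mul (hF : RSmooth F) (hG : RSmooth G) : RSmooth (F * G) := ContDiffOn.mul hF hG

lemma const (c : ℂ) : RSmooth fun _ ↦ c := contDiffOn_const

lemma const_smul (c : ℂ) (hF : RSmooth F) : RSmooth (c • F) :=
  ContDiffOn.const_smul c hF

lemma sum {ι : Type*} (s : Finset ι) {F : ι → ℍ → ℂ} (h : ∀ i ∈ s, RSmooth (F i)) :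
    RSmooth (∑ i ∈ s, F i) := by
  classical
  induction s using Finset.induction_on with
  | empty => exact const 0
  | insert a s ha ih =>
    rw [Finset.sum_insert ha]
    exact (h a (Finset.mem_insert_self _ _)).add
      (ih fun i hi ↦ h i (Finset.mem_insert_of_mem hi))

lemma star_comp (hF : RSmooth F) : RSmooth fun τ ↦ conj (F τ) :=
  (Complex.conjCLE.contDiff (n := ∞)).comp_contDiffOn hF

lemma of_mdiff (hF : MDiff F) : RSmooth F := by
  rw [UpperHalfPlane.mdifferentiable_iff] at hF
  exact (hF.contDiffOn isOpen_im_pos).restrict_scalars ℝ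

lemma im_zpow (n : ℤ) : RSmooth fun τ ↦ (τ.im : ℂ) ^ n := by
  have h : ContDiffOn ℝ ∞ (fun z : ℂ ↦ ((z.im : ℂ)) ^ n) {z | 0 < z.im} := by
    intro z hz
    have h1 : ContDiffAt ℝ ∞ (fun z : ℂ ↦ (z.im : ℂ)) z :=
      (Complex.ofRealCLM.contDiff.comp Complex.imCLM.contDiff).contDiffAt
    have hz' : (z.im : ℂ) ≠ 0 := by exact_mod_cast (ne_of_gt hz)
    have h2 : ContDiffAt ℝ ∞ (fun w : ℂ ↦ w ^ n) (z.im : ℂ) := by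
      have : AnalyticAt ℂ (fun w : ℂ ↦ w ^ n) (z.im : ℂ) := analyticAt_id.zpow hz'
      exact this.contDiffAt.restrict_scalars ℝ
    exact (h2.comp z h1).contDiffWithinAt
  refine h.congr fun z hz ↦ ?_
  simp [ofComplex_apply_of_im_pos hz]

end RSmooth

/-! ### Wirtinger calculus -/

/-- The Wirtinger derivative of a real linear map. -/
def wirtingerLin (L : ℂ →L[ℝ] ℂ) : ℂ := (1 / 2) * (L 1 - I * L I)

lemma wirtinger_eq (F : ℍ → ℂ) (τ : ℍ) :
    wirtinger F τ = wirtingerLin (fderiv ℝ (F ∘ ofComplex) (τ : ℂ)) := rfl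

lemma wirtinger_eq_of_hasFDerivAt {F : ℍ → ℂ} {τ : ℍ} {L : ℂ →L[ℝ] ℂ}
    (h : HasFDerivAt (F ∘ ofComplex) L (τ : ℂ)) : wirtinger F τ = wirtingerLin L := by
  rw [wirtinger_eq, h.fderiv]

lemma wirtinger_of_hasDerivAt {F : ℍ → ℂ} {τ : ℍ} {c : ℂ}
    (h : HasDerivAt (F ∘ ofComplex) c (τ : ℂ)) : wirtinger F τ = c := by
  rw [wirtinger_eq_of_hasFDerivAt (h.hasFDerivAt.restrictScalars ℝ)]
  simp only [wirtingerLin, ContinuousLinearMap.coe_restrictScalars',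
    ContinuousLinearMap.toSpanSingleton_apply, smul_eq_mul]
  linear_combination (-c / 2) * I_mul_I

lemma wirtinger_of_mdiff {F : ℍ → ℂ} (hF : MDiff F) (τ : ℍ) :
    wirtinger F τ = deriv (F ∘ ofComplex) τ :=
  wirtinger_of_hasDerivAt (UpperHalfPlane.mdifferentiableAt_iff.mp (hF τ)).hasDerivAt

lemma wirtinger_conj_of_mdiff {F : ℍ → ℂ} (hF : MDiff F) (τ : ℍ) :
    wirtinger (fun τ ↦ conj (F τ)) τ = 0 := by
  have h := (UpperHalfPlane.mdifferentiableAt_iff.mp (hF τ)).hasDerivAt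
  have h' := (Complex.conjCLE : ℂ →L[ℝ] ℂ).hasFDerivAt.comp (τ : ℂ)
    (h.hasFDerivAt.restrictScalars ℝ)
  rw [wirtinger_eq_of_hasFDerivAt h']
  simp only [wirtingerLin, ContinuousLinearMap.coe_comp, Function.comp_apply,
    ContinuousLinearMap.coe_restrictScalars', ContinuousLinearMap.toSpanSingleton_apply,
    smul_eq_mul, ContinuousLinearEquiv.coe_coe, conjCLE_apply, map_mul, conj_I]
  simp only [map_one]
  linear_combination (conj (deriv (F ∘ ofComplex) ↑τ) / 2) * I_mul_I

lemma wirtinger_add {F G : ℍ → ℂ} (hF : RSmooth F) (hG : RSmooth G) (τ : ℍ) :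
    wirtinger (F + G) τ = wirtinger F τ + wirtinger G τ := by
  rw [wirtinger_eq_of_hasFDerivAt (F := F + G)
    ((hF.differentiableAt τ).hasFDerivAt.add (hG.differentiableAt τ).hasFDerivAt)]
  simp only [wirtinger_eq, wirtingerLin, add_apply]
  ring

lemma wirtinger_mul {F G : ℍ → ℂ} (hF : RSmooth F) (hG : RSmooth G) (τ : ℍ) :
    wirtinger (F * G) τ = wirtinger F τ * G τ + F τ * wirtinger G τ := by
  rw [wirtinger_eq_of_hasFDerivAt (F := F * G)
    ((hF.differentiableAt τ).hasFDerivAt.mul (hG.differentiableAt τ).hasFDerivAt)]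
  simp only [wirtinger_eq, wirtingerLin, add_apply,
    smul_apply, smul_eq_mul, Function.comp_apply, ofComplex_apply]
  ring

lemma wirtinger_im_zpow (n : ℤ) (τ : ℍ) :
    wirtinger (fun τ ↦ (τ.im : ℂ) ^ n) τ = n / (2 * I) * (τ.im : ℂ) ^ (n - 1) := by
  have hy : (τ.im : ℂ) ≠ 0 := by exact_mod_cast τ.im_ne_zero
  have h1 : HasFDerivAt (fun z : ℂ ↦ (z.im : ℂ))
      (Complex.ofRealCLM.comp Complex.imCLM) (τ : ℂ) :=
    (Complex.ofRealCLM.comp Complex.imCLM).hasFDerivAt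
  have h2 := (hasDerivAt_zpow n ((τ : ℂ).im : ℂ) (Or.inl hy)).hasFDerivAt.restrictScalars ℝ
  have h3 := h2.comp (τ : ℂ) h1
  have h4 : ((fun τ : ℍ ↦ (τ.im : ℂ) ^ n) ∘ ofComplex) =ᶠ[𝓝 (τ : ℂ)]
      ((fun w : ℂ ↦ w ^ n) ∘ fun z : ℂ ↦ (z.im : ℂ)) := by
    filter_upwards [isOpen_im_pos.mem_nhds τ.im_pos] with z hz
    simp [ofComplex_apply_of_im_pos hz]
  rw [wirtinger_eq_of_hasFDerivAt (h3.congr_of_eventuallyEq h4)]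
  simp [wirtingerLin]
  field_simp
  linear_combination (-n : ℂ) * I_sq

lemma RSmooth.wirtinger {F : ℍ → ℂ} (hF : RSmooth F) : RSmooth (wirtinger F) := by
  have h : ContDiffOn ℝ ∞ (fderiv ℝ (F ∘ ofComplex)) {z | 0 < z.im} :=
    ContDiffOn.fderiv_of_isOpen hF isOpen_im_pos (by simp)
  have h2 : ContDiffOn ℝ ∞ (fun z ↦ wirtingerLin (fderiv ℝ (F ∘ ofComplex) z))
      {z | 0 < z.im} := by
    unfold wirtingerLin
    exact contDiffOn_const.mul ((h.clm_apply contDiffOn_const).sub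
      (contDiffOn_const.mul (h.clm_apply contDiffOn_const)))
  refine h2.congr fun z hz ↦ ?_
  simp only [Function.comp_apply, wirtinger_eq, ofComplex_apply_of_im_pos hz]

/-! ### Maass-Shimura operators: Leibniz rule and equivariance -/

lemma shimura_eq (w : ℤ) (F : ℍ → ℂ) :
    shimura w F = (1 / (2 * Real.pi * I) : ℂ) • (wirtinger F +
      (fun _ ↦ (w : ℂ) / (2 * I)) * (fun τ : ℍ ↦ (τ.im : ℂ) ^ (-1 : ℤ)) * F) := by
  ext τ
  have hy : (τ.im : ℂ) ≠ 0 := by exact_mod_cast τ.im_ne_zero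
  simp only [shimura, Pi.smul_apply, Pi.add_apply, Pi.mul_apply, smul_eq_mul, zpow_neg_one]
  field_simp

lemma RSmooth.shimura {F : ℍ → ℂ} (hF : RSmooth F) (w : ℤ) : RSmooth (shimura w F) := by
  rw [shimura_eq]
  exact (hF.wirtinger.add (((RSmooth.const _).mul (RSmooth.im_zpow _)).mul hF)).const_smul _

lemma RSmooth.shimuraIter {F : ℍ → ℂ} (hF : RSmooth F) (w : ℤ) (m : ℕ) :
    RSmooth (shimuraIter w m F) := by
  induction m with
  | zero => exact hF
  | succ m ih => exact ih.shimura _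

lemma shimura_mul {F G : ℍ → ℂ} (hF : RSmooth F) (hG : RSmooth G) (v w : ℤ) :
    shimura (v + w) (F * G) = shimura v F * G + F * shimura w G := by
  ext τ
  simp only [shimura, Pi.add_apply, Pi.mul_apply, wirtinger_mul hF hG]
  push_cast
  ring

/-- `wirtingerLin` extracts `A` from `L z = A z + B z̄`. This is the chain rule for a holomorphic
substitution with derivative `a`. -/
lemma wirtingerLin_comp_mul (L : ℂ →L[ℝ] ℂ) (a : ℂ) :
    (1 / 2) * (L a - I * L (I * a)) = a * wirtingerLin L := by
  have h1 : L a = a.re * L 1 + a.im * L I := by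
    conv_lhs => rw [show a = a.re • (1 : ℂ) + a.im • I by simp [Complex.re_add_im]]
    rw [map_add, map_smul, map_smul, real_smul, real_smul]
  have h2 : L (I * a) = a.re * L I - a.im * L 1 := by
    conv_lhs => rw [show I * a = a.re • I - a.im • (1 : ℂ) by
      conv_lhs => rw [← Complex.re_add_im a]
      simp only [real_smul]
      linear_combination a.im * I_mul_I]
    rw [map_sub, map_smul, map_smul, real_smul, real_smul]
  rw [h1, h2, wirtingerLin]
  conv_rhs => rw [← Complex.re_add_im a]
  linear_combination (a.im * L I / 2) * I_mul_I

/-- Differentiating the automorphy factor `j^(-w)` produces an extra term `-w c j^(-w-1) F(γτ)`. The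
term `w/(2iy)` is there to absorb it, because `1/Im(γτ) = j (j - 2icy)/y`. -/
lemma shimura_slash {F : ℍ → ℂ} (hF : RSmooth F) (w : ℤ) (γ : SL(2, ℤ)) :
    shimura w F ∣[w + 2] γ = shimura w (F ∣[w] γ) := by
  ext τ
  have hdet : (γ : GL (Fin 2) ℝ).val.det = 1 := by
    rw [← Matrix.GeneralLinearGroup.val_det_apply]; simp
  set j := denom (γ : GL (Fin 2) ℝ) (τ : ℂ) with hj
  have hj0 : j ≠ 0 := denom_ne_zero _ τ
  have hy : (τ.im : ℂ) ≠ 0 := by exact_mod_cast τ.im_ne_zero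
  have h_smul : HasDerivAt (fun z ↦ ↑((γ : GL (Fin 2) ℝ) • ofComplex z) : ℂ → ℂ)
      (1 / j ^ 2) (τ : ℂ) := by
    have := (hasStrictDerivAt_smul (g := (γ : GL (Fin 2) ℝ)) (by rw [hdet]; exact one_pos)
      τ).hasDerivAt
    rwa [hdet, ofReal_one] at this
  have h_den : HasDerivAt (fun z ↦ denom (γ : GL (Fin 2) ℝ) z ^ (-w))
      (-w * (γ 1 0 : ℂ) * j ^ (-w - 1)) (τ : ℂ) := by
    simpa using hasDerivAt_denom_zpow (γ : GL (Fin 2) ℝ) (-w) τ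
  have hF' : HasFDerivAt (F ∘ ofComplex) (fderiv ℝ (F ∘ ofComplex) ((γ • τ : ℍ) : ℂ))
      ((fun z ↦ ↑((γ : GL (Fin 2) ℝ) • ofComplex z) : ℂ → ℂ) τ) := by
    simp only [ofComplex_apply]
    exact (hF.differentiableAt _).hasFDerivAt
  have hcomp := (hF'.comp (τ : ℂ) (h_smul.hasFDerivAt.restrictScalars ℝ)).mul
    (h_den.hasFDerivAt.restrictScalars ℝ)
  have heq : ((F ∣[w] γ) ∘ ofComplex) =ᶠ[𝓝 (τ : ℂ)]
      fun z ↦ ((F ∘ ofComplex) ∘ fun z ↦ ↑((γ : GL (Fin 2) ℝ) • ofComplex z) : ℂ → ℂ) z *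
        denom (γ : GL (Fin 2) ℝ) z ^ (-w) := by
    filter_upwards [isOpen_im_pos.mem_nhds τ.im_pos] with z hz
    simp [ModularForm.SL_slash_apply, ofComplex_apply_of_im_pos hz, ofComplex_apply]
  have key : wirtinger (F ∣[w] γ) τ = wirtinger F (γ • τ) * (1 / j ^ 2) * j ^ (-w) +
      F (γ • τ) * (-w * (γ 1 0 : ℂ) * j ^ (-w - 1)) := by
    rw [wirtinger_eq_of_hasFDerivAt (hcomp.congr_of_eventuallyEq heq), wirtinger_eq F]
    have := wirtingerLin_comp_mul (fderiv ℝ (F ∘ ofComplex) ((γ • τ : ℍ) : ℂ)) (1 / j ^ 2)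
    simp only [wirtingerLin, add_apply, smul_apply,
      ContinuousLinearMap.coe_comp, Function.comp_apply,
      ContinuousLinearMap.coe_restrictScalars', ContinuousLinearMap.toSpanSingleton_apply,
      smul_eq_mul, ofComplex_apply, one_mul, ← hj, ← ModularGroup.sl_moeb] at this ⊢
    linear_combination (j ^ (-w)) * this -
      (F (γ • τ) * (-w * (γ 1 0 : ℂ) * j ^ (-w - 1)) / 2) * I_mul_I
  -- Writing `conj j` as `j - 2icy` removes the conjugation, so that the final identity is rational
  -- in `j`, `c` and `y`.
  have him : ((γ • τ : ℍ).im : ℂ) = τ.im / (j * (j - 2 * I * (γ 1 0 : ℂ) * τ.im)) := by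
    rw [ModularGroup.im_smul_eq_div_normSq, ofReal_div, ← Complex.mul_conj]
    congr 2
    rw [hj, ModularGroup.denom_apply]
    have hτ : conj (τ : ℂ) = τ - 2 * I * τ.im := by
      conv_rhs => rw [← Complex.re_add_im (τ : ℂ)]
      conv_lhs => rw [← Complex.re_add_im (τ : ℂ)]
      simp
      ring
    simp only [map_add, map_mul, hτ, map_intCast]
    ring
  have hjc : j - 2 * I * (γ 1 0 : ℂ) * τ.im ≠ 0 := by
    intro h0
    rw [h0, mul_zero, div_zero] at him
    exact (γ • τ).im_ne_zero (by exact_mod_cast him)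
  simp only [ModularForm.SL_slash_apply, shimura] at key ⊢
  rw [key, him, ← hj, show -(w + 2) = -w + -2 by ring, zpow_add₀ hj0, zpow_sub_one₀ hj0]
  have : j ^ (-2 : ℤ) = 1 / j ^ 2 := by rw [zpow_neg]; simp
  rw [this]
  field_simp
  ring

lemma shimuraIter_slash {F : ℍ → ℂ} (hF : RSmooth F) (w : ℤ) (m : ℕ) (γ : SL(2, ℤ)) :
    shimuraIter w m F ∣[w + 2 * m] γ = shimuraIter w m (F ∣[w] γ) := by
  induction m with
  | zero => simp [shimuraIter]
  | succ m ih =>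
    rw [shimuraIter, shimuraIter, ← ih, ← shimura_slash (hF.shimuraIter w m)]
    congr 1
    push_cast
    ring

/-! ### Iterated Maass-Shimura operators on holomorphic functions -/

/-- The function `-1 / (4 π y)`. -/
def negInvIm (τ : ℍ) : ℂ := -1 / (4 * Real.pi * τ.im)

lemma negInvIm_pow_eq (s : ℕ) :
    (fun τ ↦ negInvIm τ ^ s) = (fun _ : ℍ ↦ (-1 / (4 * Real.pi) : ℂ) ^ s) *
      fun τ ↦ (τ.im : ℂ) ^ (-(s : ℤ)) := by
  ext τ
  have hy : (τ.im : ℂ) ≠ 0 := by exact_mod_cast τ.im_ne_zero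
  simp only [negInvIm, Pi.mul_apply, zpow_neg, zpow_natCast, ← div_div, div_pow]
  field_simp

lemma RSmooth.negInvIm_pow (s : ℕ) : RSmooth fun τ ↦ negInvIm τ ^ s := by
  rw [negInvIm_pow_eq]
  exact (RSmooth.const _).mul (RSmooth.im_zpow _)

lemma wirtinger_const (c : ℂ) (τ : ℍ) : wirtinger (fun _ ↦ c) τ = 0 :=
  wirtinger_of_hasDerivAt (hasDerivAt_const _ c)

/-- The normalisation `X = -1/(4πy)` is chosen so that `(1/2πi) ∂X/∂z = -X²`. -/
lemma wirtinger_negInvIm_pow (s : ℕ) (τ : ℍ) :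
    wirtinger (fun τ ↦ negInvIm τ ^ s) τ =
      -(2 * Real.pi * I) * s * negInvIm τ ^ (s + 1) := by
  have hy : (τ.im : ℂ) ≠ 0 := by exact_mod_cast τ.im_ne_zero
  have hpi : (Real.pi : ℂ) ≠ 0 := by exact_mod_cast Real.pi_ne_zero
  have h := congrFun (negInvIm_pow_eq (s + 1)) τ
  simp only [Pi.mul_apply] at h
  rw [negInvIm_pow_eq, wirtinger_mul (RSmooth.const _) (RSmooth.im_zpow _), wirtinger_const,
    wirtinger_im_zpow, h, show -(s : ℤ) - 1 = -((s + 1 : ℕ) : ℤ) by push_cast; ring, pow_succ]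
  push_cast
  have h2 : -(s : ℂ) / (2 * I) = -(2 * Real.pi * I) * s * (-1 / (4 * Real.pi)) := by
    field_simp
    linear_combination (-4 * (s : ℂ)) * I_sq
  linear_combination ((-1 / (4 * Real.pi) : ℂ) ^ s * (τ.im : ℂ) ^ (-((s : ℤ) + 1))) * h2

lemma shimura_smul (w : ℤ) (c : ℂ) {F : ℍ → ℂ} (hF : RSmooth F) :
    shimura w (c • F) = c • shimura w F := by
  ext τ
  have h : wirtinger (c • F) τ = c * wirtinger F τ := by
    rw [show c • F = (fun _ ↦ c) * F from rfl, wirtinger_mul (RSmooth.const c) hF,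
      wirtinger_const]
    ring
  simp only [shimura, h, Pi.smul_apply, smul_eq_mul]
  ring

lemma shimura_add (w : ℤ) {F G : ℍ → ℂ} (hF : RSmooth F) (hG : RSmooth G) :
    shimura w (F + G) = shimura w F + shimura w G := by
  ext τ
  simp only [shimura, wirtinger_add hF hG, Pi.add_apply]
  ring

lemma shimura_sum (w : ℤ) {ι : Type*} (s : Finset ι) {F : ι → ℍ → ℂ}
    (h : ∀ i ∈ s, RSmooth (F i)) : shimura w (∑ i ∈ s, F i) = ∑ i ∈ s, shimura w (F i) := by
  classical
  induction s using Finset.induction_on with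
  | empty =>
    simpa using shimura_smul w 0 (RSmooth.const 0)
  | insert a s ha ih =>
    have hs : ∀ i ∈ s, RSmooth (F i) := fun i hi ↦ h i (Finset.mem_insert_of_mem hi)
    rw [Finset.sum_insert ha, Finset.sum_insert ha,
      shimura_add w (h a (Finset.mem_insert_self _ _)) (RSmooth.sum s hs), ih hs]

lemma shimura_negInvIm_pow_mul (w : ℤ) (s : ℕ) {H : ℍ → ℂ} (hH : MDiff H) (τ : ℍ) :
    shimura w ((fun τ ↦ negInvIm τ ^ s) * H) τ =
      negInvIm τ ^ s * D H τ + (w - s) * (negInvIm τ ^ (s + 1) * H τ) := by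
  have hy : (τ.im : ℂ) ≠ 0 := by exact_mod_cast τ.im_ne_zero
  have hpi : (Real.pi : ℂ) ≠ 0 := by exact_mod_cast Real.pi_ne_zero
  simp only [shimura, wirtinger_mul (RSmooth.negInvIm_pow s) (.of_mdiff hH),
    wirtinger_negInvIm_pow, wirtinger_of_mdiff hH, Derivative.normalizedDerivOfComplex,
    Pi.mul_apply, pow_succ]
  have h : (w : ℂ) / (2 * I * τ.im) = 2 * Real.pi * I * w * negInvIm τ := by
    rw [negInvIm]
    field_simp
    linear_combination (4 * w : ℂ) * I_sq
  rw [h]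
  field_simp
  ring

lemma mdiff_iterate_D {F : ℍ → ℂ} (hF : MDiff F) (n : ℕ) : MDiff (D^[n] F) := by
  induction n with
  | zero => exact hF
  | succ n ih =>
    rw [Function.iterate_succ_apply']
    exact Derivative.normalizedDerivOfComplex_mdifferentiable ih

/-- The coefficients of `δ_w^n` in terms of powers of `-1 / (4 π y)` and of holomorphic
derivatives. -/
def shimuraCoeff (w : ℤ) (n j : ℕ) : ℂ := n.choose j * ∏ i ∈ Finset.Ico j n, ((w : ℂ) + i)

lemma shimuraCoeff_self (w : ℤ) (n : ℕ) : shimuraCoeff w n n = 1 := by simp [shimuraCoeff]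

lemma shimuraCoeff_of_lt (w : ℤ) {n j : ℕ} (h : n < j) : shimuraCoeff w n j = 0 := by
  simp [shimuraCoeff, Nat.choose_eq_zero_of_lt h]

lemma shimuraCoeff_succ_zero (w : ℤ) (n : ℕ) :
    shimuraCoeff w (n + 1) 0 = (w + n) * shimuraCoeff w n 0 := by
  simp only [shimuraCoeff, Nat.choose_zero_right, Nat.cast_one, one_mul]
  rw [Finset.prod_Ico_succ_top (Nat.zero_le n)]
  ring

/-- The recursion that `δ_{w+2n}` imposes: on `X^(n-j) D^j F` it either adds a `D` or adds an `X`
with factor `(w + 2n) - (n - j) = w + n + j`. -/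
lemma shimuraCoeff_succ_succ (w : ℤ) (n j : ℕ) : shimuraCoeff w (n + 1) (j + 1) =
    shimuraCoeff w n j + (w + n + j + 1) * shimuraCoeff w n (j + 1) := by
  rcases lt_trichotomy n j with h | rfl | h
  · rw [shimuraCoeff_of_lt w (by omega), shimuraCoeff_of_lt w h, shimuraCoeff_of_lt w (by omega)]
    ring
  · rw [shimuraCoeff_self, shimuraCoeff_self, shimuraCoeff_of_lt w (by omega)]
    ring
  · have h1 : (n.choose (j + 1) : ℂ) * (j + 1) = n.choose j * (n - j) := by
      have := Nat.choose_succ_right_eq n j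
      rw [← Nat.cast_sub h.le]
      exact_mod_cast this
    simp only [shimuraCoeff]
    rw [Finset.prod_Ico_succ_top (by omega : j + 1 ≤ n), Finset.prod_eq_prod_Ico_succ_bot h,
      Nat.choose_succ_succ]
    push_cast
    linear_combination (-∏ i ∈ Finset.Ico (j + 1) n, ((w : ℂ) + i)) * h1

lemma shimuraCoeff_succ_mul (w : ℤ) {n j : ℕ} (h : j ≤ n) :
    shimuraCoeff w (n + 1) j * (n + 1 - j : ℕ) = (n + 1) * (w + n) * shimuraCoeff w n j := by
  have h1 : (n.choose j : ℂ) * (n + 1) = (n + 1).choose j * (n + 1 - j : ℕ) := by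
    exact_mod_cast Nat.choose_mul_succ_eq n j
  simp only [shimuraCoeff]
  rw [Finset.prod_Ico_succ_top h]
  linear_combination (-(∏ i ∈ Finset.Ico j n, ((w : ℂ) + i)) * (w + n)) * h1

lemma shimuraIter_eq_sum (w : ℤ) (n : ℕ) {F : ℍ → ℂ} (hF : MDiff F) (τ : ℍ) :
    shimuraIter w n F τ = ∑ j ∈ Finset.range (n + 1),
      shimuraCoeff w n j * (negInvIm τ ^ (n - j) * (D^[j] F) τ) := by
  induction n generalizing τ with
  | zero => simp [shimuraIter, shimuraCoeff]
  | succ n ih =>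
    have hfun : shimuraIter w n F = ∑ j ∈ Finset.range (n + 1),
        shimuraCoeff w n j • ((fun τ ↦ negInvIm τ ^ (n - j)) * D^[j] F) := by
      ext τ
      simp [ih, Finset.sum_apply]
    have hsm (j : ℕ) : RSmooth ((fun τ ↦ negInvIm τ ^ (n - j)) * D^[j] F) :=
      (RSmooth.negInvIm_pow _).mul (.of_mdiff (mdiff_iterate_D hF j))
    rw [shimuraIter, hfun, shimura_sum _ _ fun j _ ↦ (hsm j).const_smul _]
    simp only [shimura_smul _ _ (hsm _), Finset.sum_apply, Pi.smul_apply, smul_eq_mul,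
      shimura_negInvIm_pow_mul _ _ (mdiff_iterate_D hF _)]
    set T : ℕ → ℂ := fun j ↦ negInvIm τ ^ (n + 1 - j) * (D^[j] F) τ with hT
    have h1 : ∀ j ∈ Finset.range (n + 1), shimuraCoeff w n j *
        (negInvIm τ ^ (n - j) * D (D^[j] F) τ + (((w + 2 * n : ℤ) : ℂ) - ((n - j : ℕ) : ℂ)) *
          (negInvIm τ ^ (n - j + 1) * (D^[j] F) τ)) =
        shimuraCoeff w n j * T (j + 1) + (w + n + j) * shimuraCoeff w n j * T j := by
      intro j hj
      have hj' : j ≤ n := by simpa [Nat.lt_succ_iff] using hj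
      simp only [hT, Function.iterate_succ_apply', Nat.add_sub_add_right,
        show n + 1 - j = n - j + 1 by omega, Nat.cast_sub hj']
      push_cast
      ring
    -- Shift of index; the added top term `j = n + 1` has coefficient zero.
    have h2 : ∑ j ∈ Finset.range (n + 1), (w + n + j) * shimuraCoeff w n j * T j =
        ∑ j ∈ Finset.range (n + 1), (w + n + j + 1) * shimuraCoeff w n (j + 1) * T (j + 1) +
          (w + n) * shimuraCoeff w n 0 * T 0 := by
      have := Finset.sum_range_succ' (fun j : ℕ ↦ ((w : ℂ) + n + j) * shimuraCoeff w n j * T j)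
        (n + 1)
      rw [Finset.sum_range_succ, shimuraCoeff_of_lt w (Nat.lt_succ_self n)] at this
      simpa [add_assoc] using this
    rw [Finset.sum_congr rfl h1, Finset.sum_add_distrib, h2, Finset.sum_range_succ' _ (n + 1),
      shimuraCoeff_succ_zero]
    simp only [shimuraCoeff_succ_succ, add_mul, Finset.sum_add_distrib, hT]
    ring

/-! ### Rankin-Cohen brackets -/

open Polynomial in
/-- The polynomial in `-1 / (4 π y)` that expresses `δ_w^n F` at `τ`. -/
def shimuraPoly (w : ℤ) (n : ℕ) (F : ℍ → ℂ) (τ : ℍ) : ℂ[X] :=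
  ∑ j ∈ Finset.range (n + 1), monomial (n - j) (shimuraCoeff w n j * (D^[j] F) τ)

lemma eval_shimuraPoly (w : ℤ) (n : ℕ) {F : ℍ → ℂ} (hF : MDiff F) (τ : ℍ) :
    (shimuraPoly w n F τ).eval (negInvIm τ) = shimuraIter w n F τ := by
  rw [shimuraIter_eq_sum w n hF, shimuraPoly, Polynomial.eval_finsetSum]
  refine Finset.sum_congr rfl fun j _ ↦ ?_
  rw [Polynomial.eval_monomial]
  ring

lemma eval_zero_shimuraPoly (w : ℤ) (n : ℕ) (F : ℍ → ℂ) (τ : ℍ) :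
    (shimuraPoly w n F τ).eval 0 = (D^[n] F) τ := by
  rw [shimuraPoly, Polynomial.eval_finsetSum, Finset.sum_range_succ,
    Finset.sum_eq_zero fun j hj ↦ ?_]
  · simp [shimuraCoeff_self]
  · have : n - j ≠ 0 := by simp at hj; omega
    simp [Polynomial.eval_monomial, this]

open Polynomial in
lemma derivative_shimuraPoly_zero (w : ℤ) (F : ℍ → ℂ) (τ : ℍ) :
    derivative (shimuraPoly w 0 F τ) = 0 := by
  simp [shimuraPoly]

open Polynomial in
-- `d/dX` acts as a lowering operator, so differentiating a combination of products `δ^a F · δ^b G`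
-- in `X` gives another such combination, with one `δ` fewer in each product.
lemma derivative_shimuraPoly_succ (w : ℤ) (n : ℕ) (F : ℍ → ℂ) (τ : ℍ) :
    derivative (shimuraPoly w (n + 1) F τ) =
      C ((n + 1) * (w + n) : ℂ) * shimuraPoly w n F τ := by
  rw [shimuraPoly, shimuraPoly, derivative_sum, Finset.sum_range_succ, Finset.mul_sum]
  simp only [derivative_monomial, C_mul_monomial]
  rw [Nat.sub_self, Nat.cast_zero, mul_zero, map_zero, add_zero]
  refine Finset.sum_congr rfl fun j hj ↦ ?_
  have hj' : j ≤ n := by simpa [Nat.lt_succ_iff] using hj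
  rw [show n + 1 - j - 1 = n - j by omega]
  congr 1
  linear_combination ((D^[j] F) τ) * shimuraCoeff_succ_mul w hj'

/-- The coefficients of the `m`-th Rankin-Cohen bracket in weights `p + 1` and `q + 1`. -/
def rankinCohenCoeff (p q m a b : ℕ) : ℂ :=
  (-1) ^ a * ((p + m).choose b * (q + m).choose a : ℕ)

/-- In the `X`-derivative of the bracket, the product of index `(a, b)` arises from lowering `(a+1,
b)` and `(a, b+1)`; the two contributions cancel. -/
lemma rankinCohenCoeff_cancel (p q a b : ℕ) :
    rankinCohenCoeff p q (a + b + 1) (a + 1) b * ((a + 1) * (p + 1 + a)) +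
      rankinCohenCoeff p q (a + b + 1) a (b + 1) * ((b + 1) * (q + 1 + b)) = 0 := by
  have h1 : ((q + (a + b + 1)).choose (a + 1) : ℂ) * (a + 1) =
      (q + (a + b + 1)).choose a * (q + 1 + b) := by
    have := Nat.choose_succ_right_eq (q + (a + b + 1)) a
    rw [show q + (a + b + 1) - a = q + 1 + b by omega] at this
    exact_mod_cast this
  have h2 : ((p + (a + b + 1)).choose (b + 1) : ℂ) * (b + 1) =
      (p + (a + b + 1)).choose b * (p + 1 + a) := by
    have := Nat.choose_succ_right_eq (p + (a + b + 1)) b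
    rw [show p + (a + b + 1) - b = p + 1 + a by omega] at this
    exact_mod_cast this
  simp only [rankinCohenCoeff, pow_succ]
  push_cast
  linear_combination (-(-1) ^ a * ((p + (a + b + 1)).choose b : ℂ) * (p + 1 + a)) * h1 +
    ((-1) ^ a * ((q + (a + b + 1)).choose a : ℂ) * (q + 1 + b)) * h2

/-- The `m`-th Rankin-Cohen bracket of `F` and `G`, in weights `p + 1` and `q + 1`. -/
def rankinCohen (p q m : ℕ) (F G : ℍ → ℂ) : ℍ → ℂ :=
  ∑ ab ∈ Finset.HasAntidiagonal.antidiagonal m,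
    rankinCohenCoeff p q m ab.1 ab.2 • (D^[ab.1] F * D^[ab.2] G)

/-- In the Rankin-Cohen bracket, holomorphic derivatives may be replaced by Maass-Shimura
derivatives. -/
lemma rankinCohen_eq_shimura (p q m : ℕ) {F G : ℍ → ℂ} (hF : MDiff F) (hG : MDiff G) :
    rankinCohen p q m F G = ∑ ab ∈ Finset.HasAntidiagonal.antidiagonal m,
      rankinCohenCoeff p q m ab.1 ab.2 •
      (shimuraIter (p + 1) ab.1 F * shimuraIter (q + 1) ab.2 G) := by
  ext τ
  let P : ℕ → Polynomial ℂ := fun a ↦ shimuraPoly (p + 1) a F τ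
  let Q : ℕ → Polynomial ℂ := fun b ↦ shimuraPoly (q + 1) b G τ
  -- At fixed `τ`, `R` takes the holomorphic bracket as its value at `0` and the Maass-Shimura
  -- version as its value at `negInvIm τ`; it suffices that `R` be constant.
  let R : Polynomial ℂ := ∑ ab ∈ Finset.HasAntidiagonal.antidiagonal m,
    Polynomial.C (rankinCohenCoeff p q m ab.1 ab.2) * (P ab.1 * Q ab.2)
  have hR : Polynomial.derivative R = 0 := by
    simp only [R, Polynomial.derivative_sum, Polynomial.derivative_mul, Polynomial.derivative_C,
      zero_mul, zero_add, mul_add, Finset.sum_add_distrib]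
    rcases m with _ | m
    · simp [P, Q, derivative_shimuraPoly_zero]
    -- The extreme terms, with no derivative on the factor being lowered, drop out; both halves of
    -- the product rule then run over the same antidiagonal.
    · rw [Finset.Nat.sum_antidiagonal_succ, Finset.Nat.sum_antidiagonal_succ']
      simp only [P, Q, derivative_shimuraPoly_zero, derivative_shimuraPoly_succ, zero_mul,
        mul_zero, zero_add]
      rw [← Finset.sum_add_distrib]
      refine Finset.sum_eq_zero fun ab hab ↦ ?_
      obtain rfl := Finset.HasAntidiagonal.mem_antidiagonal.mp hab
      have := congrArg Polynomial.C (rankinCohenCoeff_cancel p q ab.1 ab.2)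
      simp only [Polynomial.C_add, Polynomial.C_mul, Polynomial.C_0] at this
      push_cast
      simp only [Polynomial.C_add, Polynomial.C_mul]
      linear_combination (P ab.1 * Q ab.2) * this
  have hc := Polynomial.eq_C_of_derivative_eq_zero hR
  have h1 : R.eval 0 = R.eval (negInvIm τ) := by rw [hc]; simp
  simpa [R, P, Q, Polynomial.eval_finsetSum, eval_zero_shimuraPoly, eval_shimuraPoly _ _ hF,
    eval_shimuraPoly _ _ hG, rankinCohen, Finset.sum_apply] using h1

lemma mdiff_rankinCohen (p q m : ℕ) {F G : ℍ → ℂ} (hF : MDiff F) (hG : MDiff G) :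
    MDiff (rankinCohen p q m F G) := by
  unfold rankinCohen
  refine MDifferentiable.sum fun ab _ ↦ MDifferentiable.const_smul _ ?_
  exact (mdiff_iterate_D hF _).mul (mdiff_iterate_D hG _)

lemma rankinCohen_smul_smul (p q m : ℕ) {F G : ℍ → ℂ} (hF : MDiff F) (hG : MDiff G) (c d : ℂ) :
    rankinCohen p q m (c • F) (d • G) = (c * d) • rankinCohen p q m F G := by
  have h (c : ℂ) {F : ℍ → ℂ} (hF : MDiff F) (n : ℕ) : D^[n] (c • F) = c • D^[n] F := by
    induction n with
    | zero => rfl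
    | succ n ih =>
      rw [Function.iterate_succ_apply', Function.iterate_succ_apply', ih,
        Derivative.normalizedDerivOfComplex_smul _ _ (mdiff_iterate_D hF n)]
  simp only [rankinCohen, h c hF, h d hG, Finset.smul_sum]
  refine Finset.sum_congr rfl fun ab _ ↦ ?_
  ext τ
  simp
  ring

lemma mdiff_slash {F : ℍ → ℂ} (hF : MDiff F) (w : ℤ) (γ : SL(2, ℤ)) : MDiff (F ∣[w] γ) := by
  rw [ModularForm.SL_slash]
  exact hF.slash w _

lemma shimuraIter_mul_slash {F G : ℍ → ℂ} (hF : RSmooth F) (hG : RSmooth G) (v w : ℤ) (a b : ℕ)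
    {u : ℤ} (hu : u = v + w + 2 * (a + b)) (γ : SL(2, ℤ)) :
    (shimuraIter v a F * shimuraIter w b G) ∣[u] γ =
      shimuraIter v a (F ∣[v] γ) * shimuraIter w b (G ∣[w] γ) := by
  rw [← shimuraIter_slash hF, ← shimuraIter_slash hG, ← ModularForm.mul_slash_SL2]
  congr 1
  rw [hu]
  ring

/-- Rankin-Cohen brackets commute with the slash action. -/
lemma rankinCohen_slash (p q m : ℕ) {F G : ℍ → ℂ} (hF : MDiff F) (hG : MDiff G)
    {u : ℤ} (hu : u = p + q + 2 + 2 * m) (γ : SL(2, ℤ)) :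
    rankinCohen p q m F G ∣[u] γ =
      rankinCohen p q m (F ∣[(p + 1 : ℤ)] γ) (G ∣[(q + 1 : ℤ)] γ) := by
  rw [rankinCohen_eq_shimura p q m hF hG,
    rankinCohen_eq_shimura p q m (mdiff_slash hF _ γ) (mdiff_slash hG _ γ),
    SlashAction.sum_slash]
  refine Finset.sum_congr rfl fun ab hab ↦ ?_
  rw [ModularForm.SL_smul_slash, shimuraIter_mul_slash (.of_mdiff hF) (.of_mdiff hG)]
  rw [hu, ← Finset.HasAntidiagonal.mem_antidiagonal.mp hab]
  push_cast
  ring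

/-! ### Growth at infinity -/

/-- Cauchy's estimate on the unit disc about `τ`; the height condition keeps the closed disc inside
the region of the bound and inside `ℍ`, and `1/(2π) ≤ 1`. -/
lemma norm_D_le {F : ℍ → ℂ} (hF : MDiff F) {A M : ℝ} (h : ∀ z : ℍ, A ≤ z.im → ‖F z‖ ≤ M)
    {τ : ℍ} (hτ : max A 0 + 2 ≤ τ.im) : ‖D F τ‖ ≤ M := by
  have him : ∀ z ∈ Metric.closedBall (τ : ℂ) 1, max A 0 + 1 ≤ z.im := by
    intro z hz
    have h1 : |(z - τ).im| ≤ 1 := (Complex.abs_im_le_norm _).trans (by simpa [Complex.dist_eq] using hz)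
    have h2 := (abs_le.mp h1).1
    simp only [sub_im, coe_im] at h2
    linarith
  have hpos : ∀ z ∈ Metric.closedBall (τ : ℂ) 1, 0 < z.im := fun z hz ↦ by
    linarith [him z hz, le_max_right A 0]
  have hd : DiffContOnCl ℂ (F ∘ ofComplex) (Metric.ball (τ : ℂ) 1) := by
    refine DifferentiableOn.diffContOnCl ?_
    rw [closure_ball _ one_ne_zero]
    exact (UpperHalfPlane.mdifferentiable_iff.mp hF).mono hpos
  have hM : ‖deriv (F ∘ ofComplex) (τ : ℂ)‖ ≤ M / 1 := by
    refine Complex.norm_deriv_le_of_forall_mem_sphere_norm_le one_pos hd fun z hz ↦ ?_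
    have hz' := Metric.sphere_subset_closedBall hz
    rw [Function.comp_apply, ofComplex_apply_of_im_pos (hpos z hz')]
    refine h _ ?_
    change A ≤ z.im
    linarith [him z hz', le_max_left A 0]
  rw [div_one] at hM
  have hpi : ‖(2 * Real.pi * I : ℂ)⁻¹‖ ≤ 1 := by
    rw [norm_inv]
    refine inv_le_one_of_one_le₀ ?_
    simp only [norm_mul, norm_ofNat, norm_real, norm_I, mul_one, Real.norm_eq_abs,
      abs_of_pos Real.pi_pos]
    linarith [Real.pi_gt_three]
  rw [Derivative.normalizedDerivOfComplex, norm_mul]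
  exact (mul_le_mul hpi hM (norm_nonneg _) zero_le_one).trans (one_mul M).le

lemma isBoundedAtImInfty_D {F : ℍ → ℂ} (hF : MDiff F) (h : IsBoundedAtImInfty F) :
    IsBoundedAtImInfty (D F) := by
  rw [isBoundedAtImInfty_iff] at h ⊢
  obtain ⟨M, A, hA⟩ := h
  exact ⟨M, max A 0 + 2, fun z hz ↦ norm_D_le hF hA hz⟩

lemma isZeroAtImInfty_D {F : ℍ → ℂ} (hF : MDiff F) (h : IsZeroAtImInfty F) :
    IsZeroAtImInfty (D F) := by
  rw [isZeroAtImInfty_iff] at h ⊢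
  intro ε hε
  obtain ⟨A, hA⟩ := h ε hε
  exact ⟨max A 0 + 2, fun z hz ↦ norm_D_le hF hA hz⟩

lemma isBoundedAtImInfty_iterate_D {F : ℍ → ℂ} (hF : MDiff F) (h : IsBoundedAtImInfty F)
    (n : ℕ) : IsBoundedAtImInfty (D^[n] F) := by
  induction n with
  | zero => exact h
  | succ n ih =>
    rw [Function.iterate_succ_apply']
    exact isBoundedAtImInfty_D (mdiff_iterate_D hF n) ih

lemma isZeroAtImInfty_iterate_D {F : ℍ → ℂ} (hF : MDiff F) (h : IsZeroAtImInfty F)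
    (n : ℕ) : IsZeroAtImInfty (D^[n] F) := by
  induction n with
  | zero => exact h
  | succ n ih =>
    rw [Function.iterate_succ_apply']
    exact isZeroAtImInfty_D (mdiff_iterate_D hF n) ih

lemma isBoundedAtImInfty_sum {ι : Type*} (s : Finset ι) {F : ι → ℍ → ℂ}
    (h : ∀ i ∈ s, IsBoundedAtImInfty (F i)) : IsBoundedAtImInfty (∑ i ∈ s, F i) :=
  sum_mem (S := boundedAtImInftySubalgebra ℂ) h

lemma isZeroAtImInfty_sum {ι : Type*} (s : Finset ι) {F : ι → ℍ → ℂ}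
    (h : ∀ i ∈ s, IsZeroAtImInfty (F i)) : IsZeroAtImInfty (∑ i ∈ s, F i) :=
  sum_mem (S := zeroAtImInftySubmodule ℂ) h

lemma isBoundedAtImInfty_negInvIm : IsBoundedAtImInfty negInvIm := by
  rw [isBoundedAtImInfty_iff]
  refine ⟨1, 1, fun z hz ↦ ?_⟩
  rw [negInvIm, norm_div, norm_neg, norm_one]
  simp only [norm_mul, norm_ofNat, norm_real, Real.norm_eq_abs, abs_of_pos Real.pi_pos,
    abs_of_pos z.im_pos]
  refine div_le_one_of_le₀ ?_ (by positivity)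
  nlinarith [Real.pi_gt_three, z.im_pos]

lemma isBoundedAtImInfty_shimuraIter (w : ℤ) (n : ℕ) {F : ℍ → ℂ} (hF : MDiff F)
    (h : IsBoundedAtImInfty F) : IsBoundedAtImInfty (shimuraIter w n F) := by
  have : shimuraIter w n F = ∑ j ∈ Finset.range (n + 1),
      shimuraCoeff w n j • (negInvIm ^ (n - j) * (D^[j] F)) := by
    ext τ
    simp [shimuraIter_eq_sum w n hF, Finset.sum_apply]
  rw [this]
  refine isBoundedAtImInfty_sum _ fun j _ ↦ ?_
  refine Subalgebra.smul_mem (boundedAtImInftySubalgebra ℂ) (mul_mem (pow_mem ?_ _) ?_) _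
  · exact isBoundedAtImInfty_negInvIm
  · exact isBoundedAtImInfty_iterate_D hF h j

lemma isZeroAtImInfty_rankinCohen (p q m : ℕ) {F G : ℍ → ℂ} (hF : MDiff F) (hG : MDiff G)
    (hF0 : IsZeroAtImInfty F) (hGb : IsBoundedAtImInfty G) :
    IsZeroAtImInfty (rankinCohen p q m F G) := by
  refine isZeroAtImInfty_sum _ fun ab _ ↦ ?_
  refine Filter.ZeroAtFilter.smul _ ?_
  exact (isZeroAtImInfty_iterate_D hF hF0 _).mul_boundedAtFilter
    (isBoundedAtImInfty_iterate_D hG hGb _)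

/-! ### Integration over the fundamental domain -/

/-- The height of the unit circle above a real point. -/
def arc (x : ℝ) : ℝ := Real.sqrt (1 - x ^ 2)

/-- Coordinates on the complex plane in which the standard fundamental domain is a half strip. -/
def fdCoord (p : ℝ × ℝ) : ℂ := ⟨p.1, arc p.1 + p.2⟩

/-- The half strip that parametrises the standard fundamental domain. -/
def fdStrip : Set (ℝ × ℝ) := Set.Icc (-1 / 2) (1 / 2) ×ˢ Set.Ici 0

lemma measurableSet_fdStrip : MeasurableSet fdStrip := measurableSet_Icc.prod measurableSet_Ici

lemma continuous_arc : Continuous arc := by unfold arc; fun_prop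

lemma continuous_fdCoord : Continuous fdCoord := by
  have h : Continuous fun p : ℝ × ℝ ↦ ((p.1 : ℂ) + (arc p.1 + p.2 : ℝ) * I) := by
    have := continuous_arc
    fun_prop
  refine h.congr fun p ↦ ?_
  apply Complex.ext <;> simp [fdCoord]

lemma fdCoord_injective : Function.Injective fdCoord := by
  rintro ⟨x, t⟩ ⟨x', t'⟩ h
  simp only [fdCoord, Complex.mk.injEq] at h
  obtain ⟨rfl, h⟩ := h
  simpa using h

lemma measurableEmbedding_fdCoord : MeasurableEmbedding fdCoord :=
  continuous_fdCoord.measurableEmbedding fdCoord_injective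

/-- `fdCoord` is a shear: each vertical line is translated by `arc x`. -/
lemma measurePreserving_fdCoord : MeasurePreserving fdCoord := by
  have h1 : MeasurePreserving (fun p : ℝ × ℝ ↦ (id p.1, arc p.1 + p.2))
      (volume.prod volume) (volume.prod volume) := by
    refine MeasurePreserving.skew_product (μa := (volume : Measure ℝ)) (μc := (volume : Measure ℝ))
      (g := fun x t : ℝ ↦ arc x + t) (MeasurePreserving.id _) ?_ ?_
    · have := continuous_arc.measurable
      fun_prop
    · exact Eventually.of_forall fun x ↦ map_add_left_eq_self _ _
  have h2 := Complex.volume_preserving_equiv_real_prod.symm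
  exact h2.comp h1

lemma fdCoord_mem_iff (p : ℝ × ℝ) : fdCoord p ∈ ((↑) '' 𝒟 : Set ℂ) ↔ p ∈ fdStrip := by
  rw [ModularGroup.coe_fd]
  obtain ⟨x, t⟩ := p
  have hn : 1 ≤ ‖fdCoord (x, t)‖ ↔ 1 ≤ x ^ 2 + (arc x + t) ^ 2 := by
    rw [← one_le_sq_iff₀ (norm_nonneg _), ← Complex.normSq_eq_norm_sq, Complex.normSq_apply]
    simp only [fdCoord, ← sq]
  simp only [Set.mem_ofPred_eq, hn, fdStrip, Set.mem_prod, Set.mem_Icc, Set.mem_Ici, abs_le]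
  change 0 < arc x + t ∧ 1 ≤ x ^ 2 + (arc x + t) ^ 2 ∧ (-(1 / 2) ≤ x ∧ x ≤ 1 / 2) ↔ _
  rw [neg_div]
  constructor
  · rintro ⟨h1, h2, h3⟩
    refine ⟨h3, ?_⟩
    have h4 : arc x ≤ arc x + t := Real.sqrt_le_iff.mpr ⟨h1.le, by linarith⟩
    linarith
  · rintro ⟨h3, h4⟩
    have h5 : 0 < 1 - x ^ 2 := by nlinarith
    have h6 : arc x ^ 2 = 1 - x ^ 2 := Real.sq_sqrt h5.le
    have h7 : 0 < arc x := Real.sqrt_pos.mpr h5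
    exact ⟨by linarith, by nlinarith, h3⟩

lemma arc_ge_half {x : ℝ} (hx : x ∈ Set.Icc (-1 / 2 : ℝ) (1 / 2)) : 1 / 2 ≤ arc x :=
  Real.le_sqrt_of_sq_le (by nlinarith [hx.1, hx.2])

lemma fdCoord_im_pos {p : ℝ × ℝ} (hp : p ∈ fdStrip) : 0 < (fdCoord p).im := by
  have := arc_ge_half hp.1
  have h2 : 0 ≤ p.2 := hp.2
  change 0 < arc p.1 + p.2
  linarith

lemma fdStrip_eq_preimage : fdStrip = fdCoord ⁻¹' ((↑) '' 𝒟 : Set ℂ) := by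
  ext p
  exact (fdCoord_mem_iff p).symm

lemma measurableSet_fd : MeasurableSet 𝒟 := ModularGroup.isClosed_fd.measurableSet

lemma preimage_image_fd : (UpperHalfPlane.coe ⁻¹' ((↑) '' 𝒟 : Set ℂ)) = 𝒟 :=
  Set.preimage_image_eq _ UpperHalfPlane.coe_injective

lemma measurePreserving_coe_fd : MeasurePreserving UpperHalfPlane.coe
    ((volume.comap UpperHalfPlane.coe).restrict 𝒟) (volume.restrict ((↑) '' 𝒟 : Set ℂ)) := by
  refine ⟨measurable_coe, ?_⟩
  have h : MeasurableSet ((↑) '' 𝒟 : Set ℂ) :=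
    measurableEmbedding_coe.measurableSet_image.mpr measurableSet_fd
  conv_lhs => rw [← preimage_image_fd]
  rw [← Measure.restrict_map measurable_coe h, measurableEmbedding_coe.map_comap,
    Measure.restrict_restrict h, Set.inter_eq_self_of_subset_left (Set.image_subset_range _ _)]

lemma measurePreserving_fdCoord_strip : MeasurePreserving fdCoord (volume.restrict fdStrip)
    (volume.restrict ((↑) '' 𝒟 : Set ℂ)) := by
  rw [fdStrip_eq_preimage]
  exact measurePreserving_fdCoord.restrict_preimage_emb measurableEmbedding_fdCoord _

/-- The density of the hyperbolic measure with respect to Lebesgue measure. -/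
def hypDensity (τ : ℍ) : NNReal := (1 / NNReal.mk τ.im τ.im_pos.le) ^ 2

lemma coe_hypDensity (τ : ℍ) : (hypDensity τ : ℝ) = (τ.im ^ 2)⁻¹ := by
  simp [hypDensity]

lemma measurable_hypDensity : Measurable hypDensity := by
  have : Continuous hypDensity := by
    refine .pow (.div₀ continuous_const ?_ ?_) _
    · exact continuous_im.subtype_mk _
    · exact fun x ↦ NNReal.ne_iff.mp x.im_ne_zero
  exact this.measurable

lemma volume_restrict_fd : (volume : Measure ℍ).restrict 𝒟 =
    ((volume.comap UpperHalfPlane.coe).restrict 𝒟).withDensity fun τ ↦ (hypDensity τ : ENNReal) := by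
  rw [volume_def, restrict_withDensity measurableSet_fd]
  rfl

lemma integrable_comap_fd_iff (Q : ℂ → ℂ) :
    Integrable (fun τ : ℍ ↦ Q τ) ((volume.comap UpperHalfPlane.coe).restrict 𝒟) ↔
      IntegrableOn (fun p ↦ Q (fdCoord p)) fdStrip := by
  exact (measurePreserving_coe_fd.integrable_comp_emb measurableEmbedding_coe (g := Q)).trans
    (measurePreserving_fdCoord_strip.integrable_comp_emb measurableEmbedding_fdCoord
      (g := Q)).symm

/-- Integrability over the fundamental domain in terms of Lebesgue measure on a half strip. -/
lemma integrableOn_fd_iff (P : ℍ → ℂ) : IntegrableOn P 𝒟 ↔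
    IntegrableOn (fun p ↦ (((fdCoord p).im ^ 2)⁻¹ : ℝ) • P (ofComplex (fdCoord p))) fdStrip := by
  rw [IntegrableOn, volume_restrict_fd,
    integrable_withDensity_iff_integrable_smul measurable_hypDensity,
    ← integrable_comap_fd_iff fun z ↦ ((z.im ^ 2)⁻¹ : ℝ) • P (ofComplex z)]
  simp only [NNReal.smul_def, coe_hypDensity, ofComplex_apply, coe_im]

/-- Integrals over the fundamental domain in terms of Lebesgue measure on a half strip. -/
lemma setIntegral_fd (P : ℍ → ℂ) : ∫ τ in 𝒟, P τ =
    ∫ p in fdStrip, (((fdCoord p).im ^ 2)⁻¹ : ℝ) • P (ofComplex (fdCoord p)) := by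
  rw [volume_restrict_fd, integral_withDensity_eq_integral_smul measurable_hypDensity]
  have h1 := measurePreserving_coe_fd.integral_comp measurableEmbedding_coe
    fun z ↦ ((z.im ^ 2)⁻¹ : ℝ) • P (ofComplex z)
  have h2 := measurePreserving_fdCoord_strip.integral_comp measurableEmbedding_fdCoord
    fun z ↦ ((z.im ^ 2)⁻¹ : ℝ) • P (ofComplex z)
  rw [h2, ← h1]
  simp only [NNReal.smul_def, coe_hypDensity, ofComplex_apply, coe_im]

/-- Finiteness of the hyperbolic area: on the strip `y ≥ 1/2 + t`, so the density is dominated by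
the integrable function `(1/2 + t)⁻²`. -/
lemma integrableOn_fd_const (c : ℂ) : IntegrableOn (fun _ : ℍ ↦ c) 𝒟 := by
  rw [integrableOn_fd_iff]
  have h1 : IntegrableOn (fun t : ℝ ↦ (((1 / 2 : ℝ) + t) ^ 2)⁻¹) (Set.Ici 0) := by
    have h0 := integrableOn_Ioi_rpow_of_lt (a := -2) (c := 1 / 2) (by norm_num) (by norm_num)
    have h0' := (measurePreserving_add_left volume (1 / 2 : ℝ)).integrableOn_comp_preimage
      (measurableEmbedding_addLeft (1 / 2 : ℝ)) (f := fun t : ℝ ↦ t ^ (-2 : ℝ))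
      (s := Set.Ioi (1 / 2))
    have h2 := h0'.mpr h0
    rw [integrableOn_Ici_iff_integrableOn_Ioi]
    have h3 : (fun x : ℝ ↦ 1 / 2 + x) ⁻¹' Set.Ioi (1 / 2) = Set.Ioi 0 := by ext; simp
    rw [h3] at h2
    refine h2.congr_fun (fun t ht ↦ ?_) measurableSet_Ioi
    have ht' : (0 : ℝ) < t := ht
    simp only [Function.comp_apply]
    rw [Real.rpow_neg (by positivity)]
    norm_cast
  have h2 : IntegrableOn (fun _ : ℝ ↦ (1 : ℝ)) (Set.Icc (-1 / 2) (1 / 2)) :=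
    integrableOn_const (by simp)
  have h3 : IntegrableOn (fun p : ℝ × ℝ ↦ (1 : ℝ) * (((1 / 2 : ℝ) + p.2) ^ 2)⁻¹) fdStrip := by
    rw [fdStrip, IntegrableOn, Measure.volume_eq_prod, ← Measure.prod_restrict]
    exact h2.mul_prod h1
  refine (h3.mul_const ‖c‖).mono' ?_ ?_
  · have : Measurable fun p : ℝ × ℝ ↦ ((((fdCoord p).im ^ 2)⁻¹ : ℝ) • c) := by
      exact (((Complex.measurable_im.comp continuous_fdCoord.measurable).pow_const 2).inv).smul_const c
    exact this.aestronglyMeasurable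
  · rw [ae_restrict_iff' measurableSet_fdStrip]
    refine Eventually.of_forall fun p hp ↦ ?_
    have h4 := arc_ge_half hp.1
    have h5 : 0 ≤ p.2 := hp.2
    rw [norm_smul, one_mul, Real.norm_of_nonneg (by positivity)]
    have h6 : 1 / 2 + p.2 ≤ (fdCoord p).im := add_le_add_left h4 p.2
    gcongr

lemma integrableOn_fd_of_isBoundedAtImInfty {P : ℍ → ℂ} (hP : Continuous P)
    (hb : IsBoundedAtImInfty P) : IntegrableOn P 𝒟 := by
  obtain ⟨M, hM⟩ := ModularGroup.exists_bound_fundamental_domain_of_isBigO hP (t := 0)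
    (by simpa only [Real.rpow_zero] using! hb)
  have h := (integrableOn_fd_const (M : ℂ)).norm
  refine h.mono' hP.aestronglyMeasurable ?_
  rw [ae_restrict_iff' measurableSet_fd]
  refine Eventually.of_forall fun τ hτ ↦ ?_
  have := hM τ hτ
  rw [Real.rpow_zero, mul_one] at this
  exact this.trans (by simpa using le_abs_self M)

/-! ### Stokes' theorem on the fundamental domain -/

/-- The slope of the unit circle above a real point. -/
def arcSlope (x : ℝ) : ℝ := -x / arc x

lemma hasDerivAt_arc {x : ℝ} (hx : x ∈ Set.Icc (-1 / 2 : ℝ) (1 / 2)) :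
    HasDerivAt arc (arcSlope x) x := by
  have h0 : 1 - x ^ 2 ≠ 0 := by nlinarith [hx.1, hx.2]
  have h1 : HasDerivAt (fun x : ℝ ↦ 1 - x ^ 2) (-(2 * x)) x := by
    simpa using (hasDerivAt_pow 2 x).const_sub 1
  convert! h1.sqrt h0 using 1
  rw [arcSlope, arc, neg_div, neg_div, mul_div_mul_left _ _ two_ne_zero]

lemma differentiableAt_arcSlope {x : ℝ} (hx : x ∈ Set.Icc (-1 / 2 : ℝ) (1 / 2)) :
    DifferentiableAt ℝ arcSlope x :=
  differentiableAt_id.neg.div (hasDerivAt_arc hx).differentiableAt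
    (by linarith [arc_ge_half hx])

lemma continuousOn_arcSlope : ContinuousOn arcSlope (Set.Icc (-1 / 2) (1 / 2)) :=
  fun _ hx ↦ (differentiableAt_arcSlope hx).continuousAt.continuousWithinAt

lemma abs_arcSlope_le {x : ℝ} (hx : x ∈ Set.Icc (-1 / 2 : ℝ) (1 / 2)) : |arcSlope x| ≤ 1 := by
  have h := arc_ge_half hx
  rw [arcSlope, abs_div, abs_neg, abs_of_pos (by linarith : 0 < arc x)]
  refine div_le_one_of_le₀ ?_ (by linarith)
  exact (abs_le.mpr ⟨by linarith [hx.1], by linarith [hx.2]⟩ : |x| ≤ 1 / 2).trans h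

lemma hasFDerivAt_fdCoord {p : ℝ × ℝ} (hp : p ∈ fdStrip) :
    HasFDerivAt fdCoord ((ContinuousLinearMap.fst ℝ ℝ ℝ).smulRight (1 : ℂ) +
      (arcSlope p.1 • ContinuousLinearMap.fst ℝ ℝ ℝ +
        ContinuousLinearMap.snd ℝ ℝ ℝ).smulRight I) p := by
  have h1 : HasFDerivAt (fun p : ℝ × ℝ ↦ arc p.1)
      (arcSlope p.1 • ContinuousLinearMap.fst ℝ ℝ ℝ) p :=
    (hasDerivAt_arc hp.1).comp_hasFDerivAt p hasFDerivAt_fst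
  have h2 := ((hasFDerivAt_fst (𝕜 := ℝ) (p := p)).smul_const (1 : ℂ)).add
    ((h1.add hasFDerivAt_snd).smul_const I)
  refine h2.congr_of_eventuallyEq (Eventually.of_forall fun q ↦ ?_)
  apply Complex.ext <;> simp [fdCoord]

lemma hasFDerivAt_comp_fdCoord {h : ℍ → ℂ} (hs : RSmooth h) {p : ℝ × ℝ} (hp : p ∈ fdStrip) :
    HasFDerivAt (fun p ↦ h (ofComplex (fdCoord p)))
      ((fderiv ℝ (h ∘ ofComplex) (fdCoord p)).comp
        ((ContinuousLinearMap.fst ℝ ℝ ℝ).smulRight (1 : ℂ) +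
      (arcSlope p.1 • ContinuousLinearMap.fst ℝ ℝ ℝ +
        ContinuousLinearMap.snd ℝ ℝ ℝ).smulRight I)) p := by
  have h1 : DifferentiableAt ℝ (h ∘ ofComplex) (fdCoord p) := by
    simpa using hs.differentiableAt ⟨fdCoord p, fdCoord_im_pos hp⟩
  exact h1.hasFDerivAt.comp p (hasFDerivAt_fdCoord hp)

lemma continuousOn_comp_fdCoord {h : ℍ → ℂ} (hs : RSmooth h) :
    ContinuousOn (fun p ↦ h (ofComplex (fdCoord p))) fdStrip :=
  hs.continuousOn.comp continuous_fdCoord.continuousOn fun _ hp ↦ fdCoord_im_pos hp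

lemma Icc_subset_fdStrip (B : ℝ) :
    Set.Icc ((-1 / 2, 0) : ℝ × ℝ) (1 / 2, B) ⊆ fdStrip := fun _ hp ↦
  ⟨⟨hp.1.1, hp.2.1⟩, hp.1.2⟩

/-- The boundary integrand on the horizontal edges of the half strip. -/
def edgeForm (h : ℍ → ℂ) (p : ℝ × ℝ) : ℂ :=
  -((arcSlope p.1 : ℂ) + I) * h (ofComplex (fdCoord p))

lemma hasFDerivAt_edgeForm {h : ℍ → ℂ} (hs : RSmooth h) {p : ℝ × ℝ} (hp : p ∈ fdStrip) :
    ∃ L : ℝ × ℝ →L[ℝ] ℂ, HasFDerivAt (edgeForm h) L p ∧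
      L (0, 1) = -((arcSlope p.1 : ℂ) + I) * fderiv ℝ (h ∘ ofComplex) (fdCoord p) I := by
  have h1 : HasDerivAt (fun x : ℝ ↦ -((arcSlope x : ℂ) + I))
      (-((deriv arcSlope p.1 : ℝ) : ℂ)) p.1 :=
    (((differentiableAt_arcSlope hp.1).hasDerivAt.ofReal_comp).add_const I).neg
  have h2 := h1.hasFDerivAt.comp p hasFDerivAt_fst
  have h3 := h2.mul (hasFDerivAt_comp_fdCoord hs hp)
  refine ⟨_, h3, ?_⟩
  simp

/-- With `s` the slope of the arc and `k = h ∘ fdCoord`, the chain rule gives `2 ∂h/∂z = ∂ₓ k +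
∂ₜ(-(s + i) k)`, so the divergence theorem applies. The vertical edges cancel by periodicity. -/
lemma setIntegral_wirtinger_rectangle {h : ℍ → ℂ} (hs : RSmooth h)
    (hT : ∀ τ : ℍ, h ((1 : ℝ) +ᵥ τ) = h τ) {B : ℝ} (hB : 0 ≤ B) :
    ∫ p in Set.Icc ((-1 / 2, 0) : ℝ × ℝ) (1 / 2, B),
      2 * wirtinger h (ofComplex (fdCoord p)) =
    (∫ x in (-1 / 2 : ℝ)..(1 / 2), edgeForm h (x, B)) -
      ∫ x in (-1 / 2 : ℝ)..(1 / 2), edgeForm h (x, 0) := by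
  set k : ℝ × ℝ → ℂ := fun p ↦ h (ofComplex (fdCoord p)) with hk
  have hsub := Icc_subset_fdStrip B
  have hdiv : ∀ p ∈ Set.Icc ((-1 / 2, 0) : ℝ × ℝ) (1 / 2, B),
      2 * wirtinger h (ofComplex (fdCoord p)) =
        fderiv ℝ k p (1, 0) + fderiv ℝ (edgeForm h) p (0, 1) := by
    intro p hp
    obtain ⟨L, hL, hL'⟩ := hasFDerivAt_edgeForm hs (hsub hp)
    have h1 := hasFDerivAt_comp_fdCoord hs (hsub hp)
    rw [hL.fderiv, hL', h1.fderiv, wirtinger_eq, wirtingerLin,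
      ofComplex_apply_of_im_pos (fdCoord_im_pos (hsub hp))]
    simp only [ContinuousLinearMap.coe_comp, Function.comp_apply, add_apply,
      ContinuousLinearMap.smulRight_apply, ContinuousLinearMap.coe_fst', one_smul,
      smul_apply, ContinuousLinearMap.coe_snd', smul_eq_mul, mul_one, add_zero, map_add, map_smul]
    simp only [real_smul]
    ring
  have hW : ContinuousOn (fun p ↦ 2 * wirtinger h (ofComplex (fdCoord p)))
      (Set.Icc ((-1 / 2, 0) : ℝ × ℝ) (1 / 2, B)) :=
    continuousOn_const.mul ((continuousOn_comp_fdCoord hs.wirtinger).mono hsub)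
  have hkc : ContinuousOn k (Set.Icc ((-1 / 2, 0) : ℝ × ℝ) (1 / 2, B)) :=
    (continuousOn_comp_fdCoord hs).mono hsub
  have hIoo : Set.Ioo (-1 / 2 : ℝ) (1 / 2) ×ˢ Set.Ioo 0 B ⊆ fdStrip := fun p hp ↦
    ⟨⟨hp.1.1.le, hp.1.2.le⟩, hp.2.1.le⟩
  rw [setIntegral_congr_fun measurableSet_Icc hdiv]
  rw [integral_divergence_prod_Icc_of_hasFDerivAt_off_countable_of_le k (edgeForm h)
    (fderiv ℝ k) (fderiv ℝ (edgeForm h)) (-1 / 2, 0) (1 / 2, B)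
    ⟨by norm_num, hB⟩ ∅ Set.countable_empty hkc ?_ ?_ ?_ ?_]
  · have hside : ∀ t ∈ Set.uIcc 0 B, k (1 / 2, t) = k (-1 / 2, t) := by
      intro t ht
      rw [Set.uIcc_of_le hB] at ht
      have h1 : ((1 / 2, t) : ℝ × ℝ) ∈ fdStrip := ⟨⟨by norm_num, le_rfl⟩, ht.1⟩
      have h2 : ((-1 / 2, t) : ℝ × ℝ) ∈ fdStrip := ⟨⟨le_rfl, by norm_num⟩, ht.1⟩
      simp only [hk]
      rw [ofComplex_apply_of_im_pos (fdCoord_im_pos h1),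
        ofComplex_apply_of_im_pos (fdCoord_im_pos h2),
        ← hT ⟨fdCoord (-1 / 2, t), fdCoord_im_pos h2⟩]
      congr 1
      apply UpperHalfPlane.ext
      rw [coe_vadd]
      apply Complex.ext <;> simp [fdCoord, arc] <;> norm_num
    rw [intervalIntegral.integral_congr hside]
    ring
  · refine ContinuousOn.mul ?_ hkc
    refine ((continuous_ofReal.comp_continuousOn (continuousOn_arcSlope.comp
      continuous_fst.continuousOn fun p hp ↦ (hsub hp).1)).add continuousOn_const).neg
  · intro p hp
    exact (hasFDerivAt_comp_fdCoord hs (hIoo hp.1)).differentiableAt.hasFDerivAt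
  · intro p hp
    obtain ⟨L, hL, -⟩ := hasFDerivAt_edgeForm hs (hIoo hp.1)
    exact hL.differentiableAt.hasFDerivAt
  · exact (hW.congr fun p hp ↦ (hdiv p hp).symm).integrableOn_compact isCompact_Icc

/-- Up to a constant the integrand is `h dz̄`, which is invariant under the inversion. The inversion
maps the arc to itself by `x ↦ -x`, reversing orientation, so the integrand is odd in `x`. -/
lemma integral_edgeForm_arc {h : ℍ → ℂ}
    (hS : ∀ τ : ℍ, h (ModularGroup.S • τ) = conj (τ : ℂ) ^ 2 * h τ) :
    ∫ x in (-1 / 2 : ℝ)..(1 / 2), edgeForm h (x, 0) = 0 := by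
  have hodd : ∀ x ∈ Set.uIcc (-1 / 2 : ℝ) (1 / 2), edgeForm h (-x, 0) = -edgeForm h (x, 0) := by
    intro x hx
    rw [Set.uIcc_of_le (by norm_num)] at hx
    have hx' : -x ∈ Set.Icc (-1 / 2 : ℝ) (1 / 2) :=
      ⟨by linarith [hx.2], by linarith [hx.1]⟩
    have h1 : ((x, 0) : ℝ × ℝ) ∈ fdStrip := ⟨hx, Set.mem_Ici.mpr le_rfl⟩
    have h2 : ((-x, 0) : ℝ × ℝ) ∈ fdStrip := ⟨hx', Set.mem_Ici.mpr le_rfl⟩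
    have harc : arc (-x) = arc x := by simp [arc]
    have hpos : 0 < arc x := by linarith [arc_ge_half hx]
    have hsq : arc x ^ 2 = 1 - x ^ 2 := Real.sq_sqrt (by nlinarith [hx.1, hx.2])
    have hz : fdCoord (x, 0) = x + arc x * I := by
      apply Complex.ext <;> simp [fdCoord]
    have hsqC : (arc x : ℂ) ^ 2 = 1 - (x : ℂ) ^ 2 := by exact_mod_cast hsq
    set τ : ℍ := ⟨fdCoord (x, 0), fdCoord_im_pos h1⟩ with hτ
    have hSτ : (⟨fdCoord (-x, 0), fdCoord_im_pos h2⟩ : ℍ) = ModularGroup.S • τ := by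
      rw [UpperHalfPlane.modular_S_smul]
      apply UpperHalfPlane.ext
      change fdCoord (-x, 0) = (-fdCoord (x, 0))⁻¹
      have hz' : fdCoord (-x, 0) = -x + arc x * I := by
        apply Complex.ext <;> simp [fdCoord, harc]
      refine eq_inv_of_mul_eq_one_left ?_
      rw [hz, hz']
      linear_combination (-(arc x : ℂ) ^ 2) * I_sq + hsqC
    simp only [edgeForm]
    rw [ofComplex_apply_of_im_pos (fdCoord_im_pos h2), ofComplex_apply_of_im_pos
      (fdCoord_im_pos h1), hSτ, hS, ← hτ]
    have hc : conj (τ : ℂ) = x - arc x * I := by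
      change conj (fdCoord (x, 0)) = _
      rw [hz]
      simp [sub_eq_add_neg]
    have hs1 : (arcSlope (-x) : ℂ) = x / arc x := by simp [arcSlope, harc]
    have hs2 : (arcSlope x : ℂ) = -x / arc x := by simp [arcSlope]
    have hne : (arc x : ℂ) ≠ 0 := by exact_mod_cast hpos.ne'
    rw [hc, hs1, hs2]
    -- The transformation of `dz̄` under the inversion, using `x² + arc(x)² = 1`.
    have hkey : ((x : ℂ) / arc x + I) * (x - arc x * I) ^ 2 = -(-(x : ℂ) / arc x + I) := by
      field_simp
      linear_combination (-(x : ℂ) * arc x ^ 2 + arc x ^ 3 * I) * I_sq + (x - arc x * I) * hsqC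
    linear_combination (-h τ) * hkey
  have h1 : ∫ x in (-1 / 2 : ℝ)..(1 / 2), edgeForm h (-x, 0) =
      ∫ x in (-1 / 2 : ℝ)..(1 / 2), edgeForm h (x, 0) := by
    have := intervalIntegral.integral_comp_neg (a := (-1 / 2 : ℝ)) (b := 1 / 2)
      fun x ↦ edgeForm h (x, 0)
    rw [this]
    norm_num
  rw [intervalIntegral.integral_congr hodd, intervalIntegral.integral_neg] at h1
  exact self_eq_neg.mp h1.symm

lemma tendsto_integral_edgeForm {h : ℍ → ℂ} (h0 : IsZeroAtImInfty h) :
    Tendsto (fun n : ℕ ↦ ∫ x in (-1 / 2 : ℝ)..(1 / 2), edgeForm h (x, n)) atTop (𝓝 0) := by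
  rw [isZeroAtImInfty_iff] at h0
  rw [Metric.tendsto_atTop]
  intro ε hε
  -- The factor `|s + i|` is at most `2` and the edge has length `1`, so the integral is at most
  -- `ε/2`.
  obtain ⟨A, hA⟩ := h0 (ε / 4) (by positivity)
  obtain ⟨n₀, hn₀⟩ := exists_nat_ge A
  refine ⟨n₀, fun n hn ↦ ?_⟩
  have hb : ∀ x ∈ Set.uIoc (-1 / 2 : ℝ) (1 / 2), ‖edgeForm h (x, n)‖ ≤ 2 * (ε / 4) := by
    intro x hx
    rw [Set.uIoc_of_le (by norm_num)] at hx
    have hx' : x ∈ Set.Icc (-1 / 2 : ℝ) (1 / 2) := ⟨hx.1.le, hx.2⟩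
    have hp : ((x, (n : ℝ)) : ℝ × ℝ) ∈ fdStrip := ⟨hx', Set.mem_Ici.mpr (Nat.cast_nonneg n)⟩
    rw [edgeForm, norm_mul, norm_neg, ofComplex_apply_of_im_pos (fdCoord_im_pos hp)]
    refine mul_le_mul ?_ ?_ (norm_nonneg _) (by norm_num)
    · refine (norm_add_le _ _).trans ?_
      rw [norm_real, norm_I, Real.norm_eq_abs]
      linarith [abs_arcSlope_le hx']
    · refine hA _ ?_
      change A ≤ arc x + n
      have : (n₀ : ℝ) ≤ n := by exact_mod_cast hn
      linarith [arc_ge_half hx']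
  have := intervalIntegral.norm_integral_le_of_norm_le_const hb
  rw [dist_zero_right]
  refine this.trans_lt ?_
  norm_num
  linarith

/-- Stokes' theorem for the form `h dz̄` on the standard fundamental domain, for `h` invariant
under the translation and the inversion that generate the modular group. -/
theorem setIntegral_fd_wirtinger_eq_zero {h : ℍ → ℂ} (hs : RSmooth h)
    (hT : ∀ τ : ℍ, h ((1 : ℝ) +ᵥ τ) = h τ)
    (hS : ∀ τ : ℍ, h (ModularGroup.S • τ) = conj (τ : ℂ) ^ 2 * h τ)
    (h0 : IsZeroAtImInfty h)
    (hint : IntegrableOn (fun τ : ℍ ↦ (τ.im : ℂ) ^ 2 * wirtinger h τ) 𝒟) :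
    ∫ τ in 𝒟, (τ.im : ℂ) ^ 2 * wirtinger h τ = 0 := by
  have hcongr : ∀ p ∈ fdStrip, (((fdCoord p).im ^ 2)⁻¹ : ℝ) •
      (((ofComplex (fdCoord p)).im : ℂ) ^ 2 * wirtinger h (ofComplex (fdCoord p))) =
        wirtinger h (ofComplex (fdCoord p)) := by
    intro p hp
    have hpos := fdCoord_im_pos hp
    have hne : ((fdCoord p).im : ℂ) ≠ 0 := by exact_mod_cast hpos.ne'
    have him : (ofComplex (fdCoord p)).im = (fdCoord p).im := by
      rw [ofComplex_apply_of_im_pos hpos]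
      rfl
    rw [him, real_smul]
    push_cast
    field_simp
  rw [setIntegral_fd, setIntegral_congr_fun measurableSet_fdStrip hcongr]
  rw [integrableOn_fd_iff] at hint
  replace hint := hint.congr_fun hcongr measurableSet_fdStrip
  have hU : (⋃ n : ℕ, Set.Icc ((-1 / 2, 0) : ℝ × ℝ) (1 / 2, (n : ℝ))) = fdStrip := by
    refine Set.Subset.antisymm (Set.iUnion_subset fun n ↦ Icc_subset_fdStrip n) fun p hp ↦ ?_
    obtain ⟨n, hn⟩ := exists_nat_ge p.2
    exact Set.mem_iUnion.mpr ⟨n, ⟨hp.1.1, hp.2⟩, ⟨hp.1.2, hn⟩⟩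
  -- Rectangles of height `n` exhaust the strip; on each only the top edge contributes, and that
  -- contribution tends to `0`.
  have hlim := tendsto_setIntegral_of_monotone
    (s := fun n : ℕ ↦ Set.Icc ((-1 / 2, 0) : ℝ × ℝ) (1 / 2, (n : ℝ)))
    (f := fun p ↦ wirtinger h (ofComplex (fdCoord p))) (μ := volume)
    (fun n ↦ measurableSet_Icc)
    (fun m n hmn ↦ Set.Icc_subset_Icc_right ⟨le_rfl, by simpa using hmn⟩) (by rwa [hU])
  rw [hU] at hlim
  have hlim2 : Tendsto (fun n : ℕ ↦ ∫ p in Set.Icc ((-1 / 2, 0) : ℝ × ℝ) (1 / 2, (n : ℝ)),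
      wirtinger h (ofComplex (fdCoord p))) atTop (𝓝 0) := by
    have h1 := (tendsto_integral_edgeForm h0).const_mul (1 / 2 : ℂ)
    rw [mul_zero] at h1
    refine h1.congr fun n ↦ ?_
    have h2 := setIntegral_wirtinger_rectangle hs hT (Nat.cast_nonneg (α := ℝ) n)
    rw [integral_edgeForm_arc hS, sub_zero, integral_const_mul] at h2
    rw [← h2]
    ring
  exact tendsto_nhds_unique hlim hlim2

/-! ### The Petersson pairing -/

lemma wirtinger_sum {ι : Type*} (s : Finset ι) {F : ι → ℍ → ℂ} (h : ∀ i ∈ s, RSmooth (F i))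
    (τ : ℍ) : wirtinger (∑ i ∈ s, F i) τ = ∑ i ∈ s, wirtinger (F i) τ := by
  classical
  induction s using Finset.induction_on with
  | empty => exact wirtinger_const 0 τ
  | insert a s ha ih =>
    have hs : ∀ i ∈ s, RSmooth (F i) := fun i hi ↦ h i (Finset.mem_insert_of_mem hi)
    rw [Finset.sum_insert ha, Finset.sum_insert ha,
      wirtinger_add (h a (Finset.mem_insert_self _ _)) (RSmooth.sum s hs), ih hs]

lemma petersson_eq_mul (n : ℤ) (φ G : ℍ → ℂ) :
    petersson n φ G = (fun τ ↦ conj (φ τ)) * (G * fun τ ↦ (τ.im : ℂ) ^ n) := by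
  ext τ
  simp [petersson, mul_assoc]

lemma RSmooth.petersson {φ G : ℍ → ℂ} (hφ : RSmooth φ) (hG : RSmooth G) (n : ℤ) :
    RSmooth (petersson n φ G) := by
  rw [petersson_eq_mul]
  exact hφ.star_comp.mul (hG.mul (RSmooth.im_zpow n))

/-- The differential of `conj φ G y^v dz̄` is the Petersson integrand of `φ` and `δ_v G`. -/
lemma im_sq_mul_wirtinger_petersson {φ G : ℍ → ℂ} (hφ : MDiff φ) (hG : RSmooth G) (v : ℤ)
    (τ : ℍ) : (τ.im : ℂ) ^ 2 * wirtinger (petersson v φ G) τ =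
      2 * Real.pi * I * petersson (v + 2) φ (shimura v G) τ := by
  have hy : (τ.im : ℂ) ≠ 0 := by exact_mod_cast τ.im_ne_zero
  have hpi : (Real.pi : ℂ) ≠ 0 := by exact_mod_cast Real.pi_ne_zero
  rw [petersson_eq_mul, wirtinger_mul (RSmooth.of_mdiff hφ).star_comp
    (hG.mul (RSmooth.im_zpow v)), wirtinger_conj_of_mdiff hφ, wirtinger_mul hG (RSmooth.im_zpow v),
    wirtinger_im_zpow, petersson, shimura, zpow_sub_one₀ hy, zpow_add₀ hy, zpow_ofNat]
  field_simp
  ring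

/-- The weights of the two factors differ by `2`, which leaves the factor `conj j²` that makes the
sum over cosets times `dz̄` invariant. -/
lemma petersson_smul_eq (v : ℤ) (φ G : ℍ → ℂ) (γ : SL(2, ℤ)) (τ : ℍ) :
    petersson v φ G (γ • τ) =
      conj (denom γ τ) ^ 2 * petersson v (φ ∣[v + 2] γ) (G ∣[v] γ) τ := by
  have hj : denom γ τ ≠ 0 := denom_ne_zero _ τ
  have hj' : conj (denom γ τ) ≠ 0 := by simp [hj]
  have hy : (τ.im : ℂ) ≠ 0 := by exact_mod_cast τ.im_ne_zero
  simp only [petersson, ModularForm.SL_slash_apply, map_mul, map_zpow₀]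
  rw [ModularGroup.im_smul_eq_div_normSq, ofReal_div, ← Complex.mul_conj, div_zpow, mul_zpow,
    neg_add, zpow_add₀ hj', zpow_neg, zpow_neg, zpow_neg]
  norm_cast
  field_simp

/-- Left multiplication permutes the cosets, and `E` does not see the choice of representatives. -/
lemma sum_mul_out {G M : Type*} [Group G] {Γ : Subgroup G} [Fintype (G ⧸ Γ)] [AddCommMonoid M]
    {E : G → M} (hE : ∀ g, ∀ δ ∈ Γ, E (g * δ) = E g) (γ : G) :
    ∑ c : G ⧸ Γ, E (γ * Quotient.out c) = ∑ c : G ⧸ Γ, E (Quotient.out c) := by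
  have hE' : ∀ g h : G, (g : G ⧸ Γ) = h → E g = E h := fun g h hgh ↦ by
    rw [← hE g (g⁻¹ * h) (QuotientGroup.eq.mp hgh), mul_inv_cancel_left]
  refine Fintype.sum_equiv (MulAction.toPerm γ) _ _ fun c ↦ hE' _ _ ?_
  rw [QuotientGroup.out_eq', MulAction.toPerm_apply]
  conv_rhs => rw [← QuotientGroup.out_eq' c]
  rfl

/-- The pairing as a finite sum of integrals of slashed functions. -/
lemma peterssonPairing_eq_sum {N : ℕ} [Fintype (SL(2, ℤ) ⧸ Gamma1 N)] (w : ℤ) (φ F : ℍ → ℂ) :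
    peterssonPairing N w φ F = ∑ c : SL(2, ℤ) ⧸ Gamma1 N,
      ∫ τ in 𝒟, petersson w (φ ∣[w] (Quotient.out c)⁻¹) (F ∣[w] (Quotient.out c)⁻¹) τ := by
  rw [peterssonPairing, finsum_eq_sum_of_fintype]
  simp only [petersson_slash_SL]

section

variable {N : ℕ} [NeZero N]

open ConjAct Pointwise in
-- The translate is a cusp form for a conjugate of `Gamma1 N`, which is again arithmetic.
lemma cuspForm_slash_exp_decay {w : ℤ} (φ : CuspForm (Gamma1 N) w) (γ : SL(2, ℤ)) :
    ∃ c > 0, (⇑φ ∣[w] γ) =O[atImInfty] fun τ ↦ Real.exp (-c * τ.im) := by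
  have : ((toConjAct (γ : GL (Fin 2) ℝ)⁻¹) •
      (Gamma1 N : Subgroup (GL (Fin 2) ℝ))).IsArithmetic := by
    simpa [(show Rat.castHom ℝ = algebraMap ℚ ℝ by rfl), map_inv,
      Matrix.SpecialLinearGroup.map_mapGL]
      using! Subgroup.IsArithmetic.conj (Gamma1 N : Subgroup (GL (Fin 2) ℝ))
        (Matrix.SpecialLinearGroup.mapGL ℚ γ)⁻¹
  exact CuspFormClass.exp_decay_atImInfty' (CuspForm.translate φ (γ : GL (Fin 2) ℝ))

lemma isZeroAtImInfty_petersson_slash {w : ℤ} (φ : CuspForm (Gamma1 N) w) (γ : SL(2, ℤ)) (n : ℤ)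
    {G : ℍ → ℂ} (hG : IsBoundedAtImInfty G) : IsZeroAtImInfty (petersson n (⇑φ ∣[w] γ) G) := by
  obtain ⟨b, hb, hbf⟩ := cuspForm_slash_exp_decay φ γ
  -- Part of the decay rate `b` is given up to absorb the power `y^n`.
  obtain ⟨a, ha, ha'⟩ := exists_between hb
  refine IsZeroAtImInfty.of_exp_decay ⟨a, ha, ?_⟩
  apply Asymptotics.IsBigO.of_norm_left
  simp_rw [petersson, norm_mul, Complex.norm_conj, mul_comm _ ‖G _‖, norm_zpow, mul_assoc,
      Complex.norm_real, Real.norm_of_nonneg (fun {τ : ℍ} ↦ τ.im_pos).le]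
  conv_rhs => enter [τ]; rw [← one_mul (Real.exp _)]
  refine hG.norm_left.mul ((hbf.norm_left.mul <| Asymptotics.isBigO_refl _ _).trans ?_)
  refine Asymptotics.IsBigO.comp_tendsto (f := fun t : ℝ ↦ Real.exp (-b * t) * t ^ n)
     (g := fun t : ℝ ↦ Real.exp (-a * t)) ?_ tendsto_comap
  simpa using (isLittleO_exp_mul_rpow_of_lt n (neg_lt_neg ha')).isBigO

lemma integrableOn_petersson_slash {w : ℤ} (φ : CuspForm (Gamma1 N) w) (γ : SL(2, ℤ)) (n : ℤ)
    {G : ℍ → ℂ} (hG : IsBoundedAtImInfty G) (hc : Continuous G) :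
    IntegrableOn (petersson n (⇑φ ∣[w] γ) G) 𝒟 := by
  refine integrableOn_fd_of_isBoundedAtImInfty ?_
    (isZeroAtImInfty_petersson_slash φ γ n hG).isBoundedAtImInfty
  have h : Continuous (⇑φ ∣[w] γ) := (RSmooth.of_mdiff (mdiff_slash φ.holo' w γ)).continuous
  fun_prop

/-- A cusp form is orthogonal to the image of a Maass-Shimura operator. -/
theorem peterssonPairing_shimura_eq_zero {v : ℤ} (φ : CuspForm (Gamma1 N) (v + 2)) {G : ℍ → ℂ}
    (hinv : ∀ γ ∈ Gamma1 N, G ∣[v] γ = G) (hsm : ∀ γ : SL(2, ℤ), RSmooth (G ∣[v] γ))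
    (hb : ∀ γ : SL(2, ℤ), IsBoundedAtImInfty (G ∣[v] γ))
    (hb' : ∀ γ : SL(2, ℤ), IsBoundedAtImInfty (shimura v (G ∣[v] γ))) :
    peterssonPairing N (v + 2) φ (shimura v G) = 0 := by
  have : Fintype (SL(2, ℤ) ⧸ Gamma1 N) := Subgroup.fintypeQuotientOfFiniteIndex
  have hG : RSmooth G := by simpa using hsm 1
  have hφ (γ : SL(2, ℤ)) : MDiff (⇑φ ∣[v + 2] γ) := mdiff_slash φ.holo' _ γ
  set E : SL(2, ℤ) → ℍ → ℂ := fun g ↦ petersson v (⇑φ ∣[v + 2] g⁻¹) (G ∣[v] g⁻¹) with hE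
  -- Unfolding: summing over the cosets of `Gamma1 N` gives a function with the behaviour under all
  -- of `SL(2, ℤ)` that Stokes' theorem on `𝒟` requires.
  set h : ℍ → ℂ := ∑ c : SL(2, ℤ) ⧸ Gamma1 N, E (Quotient.out c) with hh
  have hEsm (g : SL(2, ℤ)) : RSmooth (E g) := (RSmooth.of_mdiff (hφ _)).petersson (hsm _) v
  have hφinv : ∀ γ ∈ Gamma1 N, ⇑φ ∣[v + 2] γ = φ := fun γ hγ ↦
    φ.slash_action_eq' _ ⟨γ, hγ, rfl⟩
  have hEinv : ∀ g, ∀ δ ∈ Gamma1 N, E (g * δ) = E g := fun g δ hδ ↦ by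
    simp only [hE, mul_inv_rev, SlashAction.slash_mul, hφinv _ (inv_mem hδ), hinv _ (inv_mem hδ)]
  have htrans (γ : SL(2, ℤ)) (τ : ℍ) : h (γ • τ) = conj (denom γ τ) ^ 2 * h τ := by
    have h1 (g : SL(2, ℤ)) : E g (γ • τ) = conj (denom γ τ) ^ 2 * E (γ⁻¹ * g) τ := by
      simp only [hE]
      rw [petersson_smul_eq, ← SlashAction.slash_mul, ← SlashAction.slash_mul, mul_inv_rev,
        inv_inv]
    simp only [hh, Finset.sum_apply, h1, ← Finset.mul_sum]
    rw [sum_mul_out (E := fun g ↦ E g τ) (fun g δ hδ ↦ by simp only [hEinv g δ hδ])]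
  have hsum (τ : ℍ) : (τ.im : ℂ) ^ 2 * wirtinger h τ =
      ∑ c : SL(2, ℤ) ⧸ Gamma1 N, 2 * Real.pi * I * petersson (v + 2)
        (⇑φ ∣[v + 2] (Quotient.out c)⁻¹) (shimura v (G ∣[v] (Quotient.out c)⁻¹)) τ := by
    rw [hh, wirtinger_sum _ fun c _ ↦ hEsm _, Finset.mul_sum]
    exact Finset.sum_congr rfl fun c _ ↦ im_sq_mul_wirtinger_petersson (hφ _) (hsm _) v τ
  have hint (γ : SL(2, ℤ)) : IntegrableOn (fun τ ↦ 2 * Real.pi * I *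
      petersson (v + 2) (⇑φ ∣[v + 2] γ) (shimura v (G ∣[v] γ)) τ) 𝒟 :=
    (integrableOn_petersson_slash φ γ (v + 2) (hb' γ) ((hsm γ).shimura v).continuous).const_mul _
  have hstokes : ∫ τ in 𝒟, (τ.im : ℂ) ^ 2 * wirtinger h τ = 0 := by
    refine setIntegral_fd_wirtinger_eq_zero (RSmooth.sum _ fun c _ ↦ hEsm _) (fun τ ↦ ?_)
      (fun τ ↦ ?_) (isZeroAtImInfty_sum _ fun c _ ↦
        isZeroAtImInfty_petersson_slash φ _ v (hb _)) ?_
    · have := htrans ModularGroup.T τ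
      rw [UpperHalfPlane.modular_T_smul] at this
      rw [this, ModularGroup.denom_apply]
      simp [ModularGroup.T]
    · rw [htrans, ModularGroup.denom_S]
    · simp only [hsum]
      exact integrable_finsetSum _ fun c _ ↦ hint _
  simp only [hsum] at hstokes
  rw [integral_finsetSum _ fun c _ ↦ hint _] at hstokes
  simp only [integral_const_mul, ← Finset.mul_sum] at hstokes
  have h2 : (2 * Real.pi * I : ℂ) ≠ 0 := two_pi_I_ne_zero
  rw [peterssonPairing_eq_sum]
  simp only [shimura_slash hG]
  exact (mul_eq_zero.mp hstokes).resolve_left h2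

end

/-! ### Nondegeneracy of the Petersson pairing -/

/-- The identity theorem, applied near the interior point `2i`. -/
lemma eq_zero_of_mdiff_of_eqOn_fdo {F : ℍ → ℂ} (hF : MDiff F) (h : ∀ τ ∈ 𝒟ᵒ, F τ = 0) :
    F = 0 := by
  have han : AnalyticOnNhd ℂ (F ∘ ofComplex) {z | 0 < z.im} :=
    (UpperHalfPlane.mdifferentiable_iff.mp hF).analyticOnNhd isOpen_im_pos
  obtain ⟨τ₀, hτ₀⟩ : ∃ τ₀ : ℍ, τ₀ ∈ 𝒟ᵒ := by
    refine ⟨⟨2 * I, by simp⟩, ?_⟩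
    rw [ModularGroup.fdo]
    refine ⟨?_, ?_⟩
    · change 1 < Complex.normSq (2 * I)
      simp only [map_mul, normSq_I, mul_one]
      norm_num [Complex.normSq_apply]
    · change |(2 * I : ℂ).re| < 1 / 2
      norm_num
  have hopen : IsOpen ((↑) '' 𝒟ᵒ : Set ℂ) :=
    isOpenEmbedding_coe.isOpenMap _ ModularGroup.isOpen_fdo
  have hev : (F ∘ ofComplex) =ᶠ[𝓝 (τ₀ : ℂ)] 0 := by
    filter_upwards [hopen.mem_nhds (Set.mem_image_of_mem _ hτ₀)] with z hz
    obtain ⟨τ, hτ, rfl⟩ := hz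
    simpa using h τ hτ
  have := han.eqOn_zero_of_preconnected_of_eventuallyEq_zero
    (convex_halfSpace_im_gt 0).isPreconnected τ₀.im_pos hev
  ext τ
  simpa using this τ.im_pos

/-- A nonnegative integrand with zero integral vanishes almost everywhere; continuity upgrades this
to every point of an open set, hence the interior `𝒟ᵒ`. -/
lemma eqOn_fdo_zero_of_setIntegral_eq_zero {P : ℍ → ℝ} (hP : Continuous P) (h0 : ∀ τ, 0 ≤ P τ)
    (hint : IntegrableOn P 𝒟) (h : ∫ τ in 𝒟, P τ = 0) : ∀ τ ∈ 𝒟ᵒ, P τ = 0 := by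
  set V : Set (ℝ × ℝ) := fdCoord ⁻¹' ((↑) '' 𝒟ᵒ : Set ℂ) with hV
  have hVopen : IsOpen V := (isOpenEmbedding_coe.isOpenMap _ ModularGroup.isOpen_fdo).preimage
    continuous_fdCoord
  have hVsub : V ⊆ fdStrip := by
    rw [fdStrip_eq_preimage]
    exact Set.preimage_mono (Set.image_mono ModularGroup.fdo_subset_fd)
  have hC : IntegrableOn (fun τ ↦ (P τ : ℂ)) 𝒟 := hint.ofReal
  have hI : ∫ τ in 𝒟, (P τ : ℂ) = 0 := by
    rw [integral_complex_ofReal, h, ofReal_zero]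
  set Q : ℝ × ℝ → ℝ := fun p ↦ ((fdCoord p).im ^ 2)⁻¹ * P (ofComplex (fdCoord p)) with hQ
  have hQC : (fun p ↦ (((fdCoord p).im ^ 2)⁻¹ : ℝ) • (P (ofComplex (fdCoord p)) : ℂ)) =
      fun p ↦ (Q p : ℂ) := by
    ext p
    simp [hQ]
  rw [integrableOn_fd_iff, hQC] at hC
  rw [setIntegral_fd, hQC, integral_complex_ofReal] at hI
  have hQint : IntegrableOn Q fdStrip := hC.re
  have hae := (setIntegral_eq_zero_iff_of_nonneg_ae
    (Eventually.of_forall fun p ↦ mul_nonneg (by positivity) (h0 _)) hQint).mp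
    (by exact_mod_cast hI)
  have hcont : ContinuousOn Q V := by
    intro p hp
    have hpos := fdCoord_im_pos (hVsub hp)
    have h1 : ContinuousAt ofComplex (fdCoord p) :=
      (contMDiffAt_ofComplex (n := 0) hpos).continuousAt
    refine ContinuousAt.continuousWithinAt (ContinuousAt.mul ?_ ?_)
    · exact ((Complex.continuous_im.comp continuous_fdCoord).pow 2).continuousAt.inv₀
        (pow_ne_zero 2 hpos.ne')
    · exact hP.continuousAt.comp (h1.comp continuous_fdCoord.continuousAt)
  have hEq := Measure.eqOn_open_of_ae_eq (ae_restrict_of_ae_restrict_of_subset hVsub hae) hVopen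
    hcont continuousOn_const
  intro τ hτ
  have hp : fdCoord (τ.re, τ.im - arc τ.re) = τ := by
    apply Complex.ext <;> simp [fdCoord]
  have := hEq (x := (τ.re, τ.im - arc τ.re)) (by
    rw [hV, Set.mem_preimage, hp]
    exact Set.mem_image_of_mem _ hτ)
  simp only [hp, ofComplex_apply, coe_im] at this
  exact (mul_eq_zero.mp this).resolve_left (inv_ne_zero (pow_ne_zero 2 τ.im_ne_zero))

lemma petersson_self (w : ℤ) (F : ℍ → ℂ) (τ : ℍ) :
    petersson w F F τ = ((‖F τ‖ ^ 2 * τ.im ^ w : ℝ) : ℂ) := by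
  rw [petersson, Complex.conj_mul']
  push_cast
  rfl

section

variable {N : ℕ} [NeZero N]

/-- The pairing is a sum of integrals of `‖φ|γ‖² y^w ≥ 0`, so each vanishes. A single coset then
gives `φ|γ = 0` on `𝒟ᵒ`, hence everywhere, and slashing back gives `φ = 0`. -/
theorem eq_zero_of_peterssonPairing_self_eq_zero {w : ℤ} (φ : CuspForm (Gamma1 N) w)
    (h : peterssonPairing N w φ φ = 0) : φ = 0 := by
  have : Fintype (SL(2, ℤ) ⧸ Gamma1 N) := Subgroup.fintypeQuotientOfFiniteIndex
  set P : SL(2, ℤ) → ℍ → ℝ := fun γ τ ↦ ‖(⇑φ ∣[w] γ) τ‖ ^ 2 * τ.im ^ w with hP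
  have hcont (γ : SL(2, ℤ)) : Continuous (⇑φ ∣[w] γ) :=
    (RSmooth.of_mdiff (mdiff_slash φ.holo' w γ)).continuous
  have hPcont (γ : SL(2, ℤ)) : Continuous (P γ) := by
    have := hcont γ
    refine (this.norm.pow 2).mul (continuous_im.zpow₀ w fun τ ↦ Or.inl τ.im_ne_zero)
  have hnonneg (γ : SL(2, ℤ)) (τ : ℍ) : 0 ≤ P γ τ :=
    mul_nonneg (by positivity) (zpow_nonneg τ.im_pos.le _)
  have hint (γ : SL(2, ℤ)) : IntegrableOn (P γ) 𝒟 := by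
    have h1 := integrableOn_petersson_slash φ γ w (CuspFormClass.zero_at_infty_slash φ γ
      ).isBoundedAtImInfty (hcont γ)
    have h2 : petersson w (⇑φ ∣[w] γ) (⇑φ ∣[w] γ) = fun τ ↦ (P γ τ : ℂ) :=
      funext fun τ ↦ petersson_self w _ τ
    rw [h2] at h1
    exact h1.re
  rw [peterssonPairing_eq_sum] at h
  have h3 : ∑ c : SL(2, ℤ) ⧸ Gamma1 N, ∫ τ in 𝒟, P (Quotient.out c)⁻¹ τ = 0 := by
    have h4 : ∀ γ : SL(2, ℤ), ∫ τ in 𝒟, petersson w (⇑φ ∣[w] γ) (⇑φ ∣[w] γ) τ =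
        ((∫ τ in 𝒟, P γ τ : ℝ) : ℂ) := fun γ ↦ by
      rw [← integral_complex_ofReal]
      simp only [petersson_self, hP]
    simp only [h4] at h
    exact_mod_cast h
  rw [Finset.sum_eq_zero_iff_of_nonneg fun c _ ↦ integral_nonneg (hnonneg _)] at h3
  obtain ⟨c⟩ : Nonempty (SL(2, ℤ) ⧸ Gamma1 N) := inferInstance
  set γ : SL(2, ℤ) := (Quotient.out c)⁻¹
  have h5 := eqOn_fdo_zero_of_setIntegral_eq_zero (hPcont γ) (hnonneg γ) (hint γ)
    (h3 c (Finset.mem_univ c))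
  have h6 : ⇑φ ∣[w] γ = 0 := by
    refine eq_zero_of_mdiff_of_eqOn_fdo (mdiff_slash φ.holo' w γ) fun τ hτ ↦ ?_
    have := (mul_eq_zero.mp (h5 τ hτ)).resolve_right (zpow_ne_zero _ τ.im_ne_zero)
    simpa using this
  have h7 : ⇑φ = 0 := by
    have := congrArg (fun F : ℍ → ℂ ↦ F ∣[w] γ⁻¹) h6
    simpa only [← SlashAction.slash_mul, mul_inv_cancel, SlashAction.slash_one,
      SlashAction.zero_slash] using this
  exact DFunLike.coe_injective h7

end

/-! ### Fourier coefficients of Rankin-Cohen brackets -/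

/-- Holomorphic functions on the upper half plane with a Fourier expansion in nonnegative powers
of `exp (2πiτ)`. -/
structure HasQExpansion (F : ℍ → ℂ) : Prop where
  periodic : Function.Periodic (F ∘ ofComplex) (1 : ℝ)
  mdiff : MDiff F
  bounded : IsBoundedAtImInfty F

namespace HasQExpansion

variable {F G : ℍ → ℂ}

lemma analyticAt (hF : HasQExpansion F) : AnalyticAt ℂ (cuspFunction 1 F) 0 :=
  analyticAt_cuspFunction_zero one_pos hF.periodic hF.mdiff hF.bounded

lemma hasSum (hF : HasQExpansion F) (τ : ℍ) :
    HasSum (fun n : ℕ ↦ (qExpansion 1 F).coeff n • Function.Periodic.qParam 1 τ ^ n) (F τ) :=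
  hasSum_qExpansion one_pos hF.periodic hF.mdiff hF.bounded τ

lemma mul (hF : HasQExpansion F) (hG : HasQExpansion G) : HasQExpansion (F * G) where
  periodic := hF.periodic.mul hG.periodic
  mdiff := hF.mdiff.mul hG.mdiff
  bounded := Filter.BoundedAtFilter.mul hF.bounded hG.bounded

lemma normalizedDeriv (hF : HasQExpansion F) :
    HasQExpansion (Derivative.normalizedDerivOfComplex F) where
  periodic := by
    intro z
    rcases le_or_gt z.im 0 with hz | hz
    · have hz' : (z + (1 : ℝ)).im ≤ 0 := by simpa using hz
      simp only [Function.comp_apply, ofComplex_apply_of_im_nonpos hz,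
        ofComplex_apply_of_im_nonpos hz']
    · have hz' : 0 < (z + (1 : ℝ)).im := by simpa using hz
      simp only [Function.comp_apply, Derivative.normalizedDerivOfComplex,
        ofComplex_apply_of_im_pos hz, ofComplex_apply_of_im_pos hz']
      congr 1
      rw [← deriv_comp_add_const]
      congr 1
      exact funext hF.periodic
  mdiff := Derivative.normalizedDerivOfComplex_mdifferentiable hF.mdiff
  bounded := isBoundedAtImInfty_D hF.mdiff hF.bounded

/-- In the variable `q` the operator `D` is `q d/dq`. -/
lemma D_apply (hF : HasQExpansion F) (τ : ℍ) :
    Derivative.normalizedDerivOfComplex F τ = Function.Periodic.qParam 1 τ *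
      deriv (cuspFunction 1 F) (Function.Periodic.qParam 1 τ) := by
  have hq : ‖Function.Periodic.qParam 1 (τ : ℂ)‖ < 1 :=
    Function.Periodic.norm_qParam_lt_one one_pos τ.im_pos
  have h1 := (differentiableAt_cuspFunction one_pos hF.periodic hF.mdiff hF.bounded hq).hasDerivAt
  have h2 : HasDerivAt (fun z ↦ Function.Periodic.qParam 1 z)
      (Function.Periodic.qParam 1 (τ : ℂ) * (2 * Real.pi * I)) (τ : ℂ) := by
    have : HasDerivAt (fun z : ℂ ↦ 2 * Real.pi * I * z / (1 : ℝ)) (2 * Real.pi * I) (τ : ℂ) := by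
      simpa using (hasDerivAt_id (τ : ℂ)).const_mul (2 * Real.pi * I)
    exact this.cexp
  have h3 : (F ∘ ofComplex) =ᶠ[𝓝 (τ : ℂ)]
      (cuspFunction 1 F ∘ fun z ↦ Function.Periodic.qParam 1 z) := by
    filter_upwards [isOpen_im_pos.mem_nhds τ.im_pos] with z hz
    have := eq_cuspFunction ⟨z, hz⟩ one_ne_zero hF.periodic
    simp only [Function.comp_apply, ofComplex_apply_of_im_pos hz]
    exact this.symm
  have h4 : (2 * Real.pi * I : ℂ) ≠ 0 := two_pi_I_ne_zero
  rw [Derivative.normalizedDerivOfComplex,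
    ((h1.comp (τ : ℂ) h2).congr_of_eventuallyEq h3).deriv]
  field_simp

lemma coeff_D (hF : HasQExpansion F) (n : ℕ) :
    (qExpansion 1 (Derivative.normalizedDerivOfComplex F)).coeff n =
      n * (qExpansion 1 F).coeff n := by
  -- Uniqueness of coefficients is stated for a `FunLike` type; bare functions are made into one.
  let : FunLike (ℍ → ℂ) ℍ ℂ := ⟨id, Function.injective_id⟩
  refine (UpperHalfPlane.qExpansion_coeff_unique (F := ℍ → ℂ) (h := 1)
    (c := fun n : ℕ ↦ (n : ℂ) * (qExpansion 1 F).coeff n)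
    (Derivative.normalizedDerivOfComplex F) one_pos hF.normalizedDeriv.analyticAt ?_ n).symm
  intro τ
  change HasSum _ (Derivative.normalizedDerivOfComplex F τ)
  rw [hF.D_apply]
  set q := Function.Periodic.qParam 1 (τ : ℂ)
  have hq : q ∈ Metric.ball (0 : ℂ) 1 := by
    simpa using Function.Periodic.norm_qParam_lt_one one_pos τ.im_pos
  have hd := (differentiableOn_cuspFunction_ball one_pos hF.periodic hF.mdiff
    hF.bounded).deriv Metric.isOpen_ball
  have h1 := (Complex.hasSum_taylorSeries_on_ball hd hq).mul_left q
  -- The Taylor series of the derivative, multiplied by `q`, starts at exponent `1`; the missing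
  -- term `n = 0` carries the factor `n`.
  have h2 := (hasSum_nat_add_iff (f := fun m : ℕ ↦
    ((m : ℂ) * (qExpansion 1 F).coeff m) • q ^ m) (g := q * deriv (cuspFunction 1 F) q) 1).mp ?_
  · simpa using h2
  · refine h1.congr_fun fun m ↦ ?_
    rw [qExpansion_coeff, iteratedDeriv_succ', Nat.factorial_succ]
    have h3 : ((m.factorial : ℕ) : ℂ) ≠ 0 := by exact_mod_cast m.factorial_ne_zero
    have h4 : ((m : ℂ) + 1) ≠ 0 := by exact_mod_cast Nat.succ_ne_zero m
    simp only [smul_eq_mul, sub_zero]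
    push_cast
    field_simp
    ring

lemma iterate_D (hF : HasQExpansion F) (a : ℕ) :
    HasQExpansion ((Derivative.normalizedDerivOfComplex)^[a] F) := by
  induction a with
  | zero => exact hF
  | succ a ih =>
    rw [Function.iterate_succ_apply']
    exact ih.normalizedDeriv

lemma coeff_iterate_D (hF : HasQExpansion F) (a n : ℕ) :
    (qExpansion 1 ((Derivative.normalizedDerivOfComplex)^[a] F)).coeff n =
      (n : ℂ) ^ a * (qExpansion 1 F).coeff n := by
  induction a with
  | zero => simp
  | succ a ih =>
    rw [Function.iterate_succ_apply', (hF.iterate_D a).coeff_D, ih, pow_succ]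
    ring

lemma hasSum_rankinCohen (hF : HasQExpansion F) (hG : HasQExpansion G) (p q m : ℕ) (τ : ℍ) :
    HasSum (fun n : ℕ ↦ (∑ ij ∈ Finset.HasAntidiagonal.antidiagonal n,
      (qExpansion 1 F).coeff ij.1 * (qExpansion 1 G).coeff ij.2 *
        ∑ ab ∈ Finset.HasAntidiagonal.antidiagonal m, rankinCohenCoeff p q m ab.1 ab.2 *
          ((ij.1 : ℂ) ^ ab.1 * (ij.2 : ℂ) ^ ab.2)) • Function.Periodic.qParam 1 τ ^ n)
      (rankinCohen p q m F G τ) := by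
  have h1 : rankinCohen p q m F G τ = ∑ ab ∈ Finset.HasAntidiagonal.antidiagonal m,
      rankinCohenCoeff p q m ab.1 ab.2 *
        ((Derivative.normalizedDerivOfComplex)^[ab.1] F *
          (Derivative.normalizedDerivOfComplex)^[ab.2] G) τ := by
    simp [rankinCohen, Finset.sum_apply]
  rw [h1]
  refine (hasSum_sum (s := Finset.HasAntidiagonal.antidiagonal m) fun ab _ ↦
    (((hF.iterate_D ab.1).mul (hG.iterate_D ab.2)).hasSum τ).mul_left
      (rankinCohenCoeff p q m ab.1 ab.2)).congr_fun fun n ↦ ?_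
  simp only [qExpansion_mul (hF.iterate_D _).analyticAt (hG.iterate_D _).analyticAt,
    PowerSeries.coeff_mul, hF.coeff_iterate_D, hG.coeff_iterate_D, smul_eq_mul,
    Finset.mul_sum, Finset.sum_mul]
  rw [Finset.sum_comm]
  refine Finset.sum_congr rfl fun ab _ ↦ Finset.sum_congr rfl fun ij _ ↦ ?_
  ring

end HasQExpansion

/-! ### Jacobi polynomials -/

lemma iteratedDeriv_add_const_pow (n i : ℕ) (c t : ℝ) :
    iteratedDeriv i (fun x : ℝ ↦ (x + c) ^ n) t = n.descFactorial i * (t + c) ^ (n - i) := by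
  rw [iteratedDeriv_comp_add_const i (fun x : ℝ ↦ x ^ n) c]
  exact iteratedDeriv_pow n i

/-- The bracket in the Rodrigues formula is `(x + 1)^m (x - 1)^(m+2k)`; Leibniz' rule gives the sum,
and terms with more than `m` derivatives on the first factor vanish. -/
lemma jacobiH_eq_sum (m k : ℕ) (t : ℝ) : jacobiH m k t = 1 / 2 ^ m *
    ∑ ab ∈ Finset.HasAntidiagonal.antidiagonal m,
      ((m + 2 * k).choose ab.2 * m.choose ab.2 : ℕ) * ((t + 1) ^ ab.1 * (t - 1) ^ ab.2) := by
  set n := m + 2 * k with hn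
  have hfun : (fun x : ℝ ↦ (x ^ 2 - 1) ^ m * (x - 1) ^ (2 * k)) =
      fun x ↦ (x + 1) ^ m * (x + (-1)) ^ n := by
    ext x
    rw [hn, pow_add, show x ^ 2 - 1 = (x + 1) * (x + -1) by ring, mul_pow, ← sub_eq_add_neg]
    ring
  have hsum : iteratedDeriv n (fun x : ℝ ↦ (x + 1) ^ m * (x + (-1)) ^ n) t = n.factorial *
      ∑ b ∈ Finset.range (m + 1),
        (n.choose b * m.choose b : ℕ) * ((t + 1) ^ (m - b) * (t - 1) ^ b) := by
    rw [iteratedDeriv_fun_mul (by fun_prop) (by fun_prop)]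
    simp only [iteratedDeriv_add_const_pow]
    rw [Finset.mul_sum]
    symm
    refine Finset.sum_subset_zero_on_sdiff (Finset.range_subset_range.mpr (by omega))
      (fun b hb ↦ ?_) fun b hb ↦ ?_
    · have : m < b := by simp at hb; omega
      simp [Nat.descFactorial_of_lt this]
    · have hb' : b ≤ m := by simpa [Nat.lt_succ_iff] using hb
      have hbn : b ≤ n := by omega
      have h1 : (m.descFactorial b : ℝ) = b.factorial * m.choose b := by
        exact_mod_cast Nat.descFactorial_eq_factorial_mul_choose m b
      have h2 : (b.factorial : ℝ) * n.descFactorial (n - b) = n.factorial := by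
        have := Nat.factorial_mul_descFactorial (Nat.sub_le n b)
        rw [Nat.sub_sub_self hbn] at this
        exact_mod_cast this
      rw [h1, Nat.sub_sub_self hbn, ← h2]
      push_cast
      ring
  rw [jacobiH, hfun, hsum, ← Finset.Nat.sum_antidiagonal_swap]
  have h := Finset.Nat.sum_antidiagonal_eq_sum_range_succ (fun b a ↦
    ((n.choose b * m.choose b : ℕ) : ℝ) * ((t + 1) ^ a * (t - 1) ^ b)) m
  simp only [Prod.fst_swap, Prod.snd_swap]
  rw [h, ← hn]
  have hf : (n.factorial : ℝ) ≠ 0 := by exact_mod_cast n.factorial_ne_zero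
  field_simp

/-- For `t = (i-j)/(i+j)` one has `t + 1 = 2i/(i+j)` and `t - 1 = -2j/(i+j)`. The powers of `2`
cancel `1/2^m`, and `(-1)^m (-1)^b = (-1)^a` matches the signs. -/
lemma sum_rankinCohenCoeff_eq_jacobiH (m k : ℕ) {i j : ℕ} (hij : i + j ≠ 0) :
    ∑ ab ∈ Finset.HasAntidiagonal.antidiagonal m, rankinCohenCoeff (2 * k) 0 m ab.1 ab.2 *
      ((i : ℂ) ^ ab.1 * (j : ℂ) ^ ab.2) =
    (-1) ^ m * ((i + j : ℕ) : ℂ) ^ m * (jacobiH m k (((i : ℝ) - j) / ((i : ℝ) + j)) : ℂ) := by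
  have hne : (i : ℂ) + j ≠ 0 := by exact_mod_cast hij
  have hneR : (i : ℝ) + j ≠ 0 := by exact_mod_cast hij
  have h1 : ((i : ℝ) - j) / ((i : ℝ) + j) + 1 = 2 * i / (i + j) := by field_simp; ring
  have h2 : ((i : ℝ) - j) / ((i : ℝ) + j) - 1 = -2 * j / (i + j) := by field_simp; ring
  rw [jacobiH_eq_sum, h1, h2]
  push_cast
  rw [Finset.mul_sum, Finset.mul_sum]
  refine Finset.sum_congr rfl fun ab hab ↦ ?_
  obtain ⟨a, b⟩ := ab
  have hm : a + b = m := Finset.HasAntidiagonal.mem_antidiagonal.mp hab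
  simp only [rankinCohenCoeff, zero_add]
  have hc : m.choose a = m.choose b := Nat.choose_symm_of_eq_add hm.symm
  have hs : (-1 : ℂ) ^ (b * 2) = 1 := by rw [mul_comm, pow_mul]; simp
  rw [hc, ← hm, add_comm (2 * k)]
  push_cast
  simp only [div_pow, mul_pow, pow_add, neg_mul, neg_pow (2 * (j : ℂ))]
  field_simp
  ring_nf
  simp only [hs]
  ring

/-! ### Linearity of the Petersson pairing -/

/-- Functions all of whose slash translates are continuous and bounded at `i∞`. -/
structure SlashBounded (w : ℤ) (F : ℍ → ℂ) : Prop where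
  continuous_slash : ∀ γ : SL(2, ℤ), Continuous (F ∣[w] γ)
  isBoundedAtImInfty_slash : ∀ γ : SL(2, ℤ), IsBoundedAtImInfty (F ∣[w] γ)

lemma SlashBounded.const_smul {w : ℤ} {F : ℍ → ℂ} (hF : SlashBounded w F) (c : ℂ) :
    SlashBounded w (c • F) where
  continuous_slash γ := by
    rw [ModularForm.SL_smul_slash]
    exact (hF.continuous_slash γ).const_smul c
  isBoundedAtImInfty_slash γ := by
    rw [ModularForm.SL_smul_slash]
    exact Filter.BoundedAtFilter.smul c (hF.isBoundedAtImInfty_slash γ)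

section

variable {N : ℕ} {w : ℤ}

lemma mdiff_modularForm (g : ModularForm (Gamma1 N) w) : MDiff ⇑g := g.holo'

lemma mdiff_cuspForm (f : CuspForm (Gamma1 N) w) : MDiff ⇑f := f.holo'

lemma shimuraIter_mul_slash_of_mem {v : ℤ} (f : CuspForm (Gamma1 N) v)
    (g : ModularForm (Gamma1 N) w) (a b : ℕ) {u : ℤ} (hu : u = v + w + 2 * (a + b))
    {γ : SL(2, ℤ)} (hγ : γ ∈ Gamma1 N) :
    (shimuraIter v a f * shimuraIter w b g) ∣[u] γ = shimuraIter v a f * shimuraIter w b g := by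
  have h1 : ⇑f ∣[v] γ = f := f.slash_action_eq' _ ⟨γ, hγ, rfl⟩
  have h2 : ⇑g ∣[w] γ = g := g.slash_action_eq' _ ⟨γ, hγ, rfl⟩
  rw [shimuraIter_mul_slash (.of_mdiff (mdiff_cuspForm f)) (.of_mdiff (mdiff_modularForm g))
    v w a b hu, h1, h2]

lemma hasNebentypus_rankinCohen {v u : ℤ} {p q : ℕ} (m : ℕ)
    (f : CuspForm (Gamma1 N) v) (g : ModularForm (Gamma1 N) w) (hv : v = p + 1) (hw : w = q + 1)
    (hu : u = v + w + 2 * m) {χ ψ : DirichletCharacter ℂ N} (hf : HasNebentypus N v χ f) (hg : HasNebentypus N w ψ g) :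
    HasNebentypus N u (χ * ψ) (rankinCohen p q m f g) := fun γ hγ ↦ by
  rw [rankinCohen_slash p q m (mdiff_cuspForm f) (mdiff_modularForm g)
    (by rw [hu, hv, hw]; ring), ← hv, ← hw, hf γ hγ,
    hg γ hγ, rankinCohen_smul_smul p q m (mdiff_cuspForm f) (mdiff_modularForm g), MulChar.mul_apply]

variable [NeZero N]

lemma SlashBounded.of_cuspForm (f : CuspForm (Gamma1 N) w) : SlashBounded w f where
  continuous_slash γ := (RSmooth.of_mdiff (mdiff_slash (mdiff_cuspForm f) w γ)).continuous
  isBoundedAtImInfty_slash γ := (CuspFormClass.zero_at_infty_slash f γ).isBoundedAtImInfty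

lemma SlashBounded.integrableOn {F : ℍ → ℂ} (hF : SlashBounded w F)
    (φ : CuspForm (Gamma1 N) w) (γ : SL(2, ℤ)) :
    IntegrableOn (petersson w (⇑φ ∣[w] γ) (F ∣[w] γ)) 𝒟 :=
  integrableOn_petersson_slash φ γ w (hF.isBoundedAtImInfty_slash γ) (hF.continuous_slash γ)

lemma peterssonPairing_add (φ : CuspForm (Gamma1 N) w) {F G : ℍ → ℂ} (hF : SlashBounded w F)
    (hG : SlashBounded w G) :
    peterssonPairing N w φ (F + G) = peterssonPairing N w φ F + peterssonPairing N w φ G := by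
  have : Fintype (SL(2, ℤ) ⧸ Gamma1 N) := Subgroup.fintypeQuotientOfFiniteIndex
  simp only [peterssonPairing_eq_sum, ← Finset.sum_add_distrib]
  refine Finset.sum_congr rfl fun c _ ↦ ?_
  rw [← integral_add (hF.integrableOn φ _) (hG.integrableOn φ _)]
  simp only [SlashAction.add_slash, petersson, Pi.add_apply]
  congr 1
  ext τ
  ring

lemma peterssonPairing_smul (φ F : ℍ → ℂ) (c : ℂ) :
    peterssonPairing N w φ (c • F) = c * peterssonPairing N w φ F := by
  have : Fintype (SL(2, ℤ) ⧸ Gamma1 N) := Subgroup.fintypeQuotientOfFiniteIndex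
  simp only [peterssonPairing_eq_sum, Finset.mul_sum]
  refine Finset.sum_congr rfl fun d _ ↦ ?_
  rw [← integral_const_mul]
  simp only [ModularForm.SL_smul_slash, petersson, Pi.smul_apply, smul_eq_mul]
  congr 1
  ext τ
  ring

lemma SlashBounded.add {F G : ℍ → ℂ} (hF : SlashBounded w F) (hG : SlashBounded w G) :
    SlashBounded w (F + G) where
  continuous_slash γ := by
    rw [SlashAction.add_slash]
    exact (hF.continuous_slash γ).add (hG.continuous_slash γ)
  isBoundedAtImInfty_slash γ := by
    rw [SlashAction.add_slash]
    exact Filter.BoundedAtFilter.add (hF.isBoundedAtImInfty_slash γ)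
      (hG.isBoundedAtImInfty_slash γ)

lemma SlashBounded.zero : SlashBounded w 0 where
  continuous_slash γ := by
    rw [SlashAction.zero_slash]
    exact continuous_const
  isBoundedAtImInfty_slash γ := by
    rw [SlashAction.zero_slash]
    exact Filter.const_boundedAtFilter _ (0 : ℂ)

lemma SlashBounded.sum {ι : Type*} (s : Finset ι) {F : ι → ℍ → ℂ}
    (h : ∀ i ∈ s, SlashBounded w (F i)) : SlashBounded w (∑ i ∈ s, F i) :=
  Finset.sum_induction F (SlashBounded w) (fun _ _ ↦ SlashBounded.add) SlashBounded.zero h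

lemma peterssonPairing_sum (φ : CuspForm (Gamma1 N) w) {ι : Type*} (s : Finset ι)
    {F : ι → ℍ → ℂ} (h : ∀ i ∈ s, SlashBounded w (F i)) :
    peterssonPairing N w φ (∑ i ∈ s, F i) = ∑ i ∈ s, peterssonPairing N w φ (F i) := by
  classical
  induction s using Finset.induction_on with
  | empty => simpa using peterssonPairing_smul (N := N) (w := w) φ 0 0
  | insert a s ha ih =>
    have hs : ∀ i ∈ s, SlashBounded w (F i) := fun i hi ↦ h i (Finset.mem_insert_of_mem hi)
    rw [Finset.sum_insert ha, Finset.sum_insert ha,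
      peterssonPairing_add φ (h a (Finset.mem_insert_self _ _)) (SlashBounded.sum s hs), ih hs]

/-- A cusp form is determined by its Petersson products with cusp forms. -/
theorem cuspForm_ext_of_peterssonPairing {h₁ h₂ : CuspForm (Gamma1 N) w}
    (h : ∀ φ : CuspForm (Gamma1 N) w, peterssonPairing N w φ h₁ = peterssonPairing N w φ h₂) :
    h₁ = h₂ := by
  refine sub_eq_zero.mp (eq_zero_of_peterssonPairing_self_eq_zero (h₁ - h₂) ?_)
  have hsub : ⇑(h₁ - h₂) = ⇑h₁ + (-1 : ℂ) • ⇑h₂ := by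
    ext τ
    simp [sub_eq_add_neg]
  have key (φ : CuspForm (Gamma1 N) w) : peterssonPairing N w φ ⇑(h₁ - h₂) = 0 := by
    rw [hsub, peterssonPairing_add _ (SlashBounded.of_cuspForm h₁)
      ((SlashBounded.of_cuspForm h₂).const_smul _), peterssonPairing_smul, h]
    ring
  exact key _

/-! ### The holomorphic projection of `f δ^m g` -/

lemma slashBounded_shimuraIter_mul {v : ℤ} (f : CuspForm (Gamma1 N) v)
    (g : ModularForm (Gamma1 N) w) (a b : ℕ) {u : ℤ} (hu : u = v + w + 2 * (a + b)) :
    SlashBounded u (shimuraIter v a f * shimuraIter w b g) where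
  continuous_slash γ := by
    rw [shimuraIter_mul_slash (.of_mdiff (mdiff_cuspForm f)) (.of_mdiff (mdiff_modularForm g))
    v w a b hu]
    exact (((RSmooth.of_mdiff (mdiff_slash (mdiff_cuspForm f) v γ)).shimuraIter v a).mul
      ((RSmooth.of_mdiff (mdiff_slash (mdiff_modularForm g) w γ)).shimuraIter w b)).continuous
  isBoundedAtImInfty_slash γ := by
    rw [shimuraIter_mul_slash (.of_mdiff (mdiff_cuspForm f)) (.of_mdiff (mdiff_modularForm g))
    v w a b hu]
    exact Filter.BoundedAtFilter.mul
      (isBoundedAtImInfty_shimuraIter v a (mdiff_slash (mdiff_cuspForm f) v γ)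
        (CuspFormClass.zero_at_infty_slash f γ).isBoundedAtImInfty)
      (isBoundedAtImInfty_shimuraIter w b (mdiff_slash (mdiff_modularForm g) w γ)
        (ModularFormClass.bdd_at_infty_slash g γ))

lemma shimura_shimuraIter_mul {F G : ℍ → ℂ} (hF : RSmooth F) (hG : RSmooth G) (v w : ℤ)
    (a b : ℕ) : shimura (v + 2 * a + (w + 2 * b)) (shimuraIter v a F * shimuraIter w b G) =
      shimuraIter v (a + 1) F * shimuraIter w b G +
        shimuraIter v a F * shimuraIter w (b + 1) G :=
  shimura_mul (hF.shimuraIter v a) (hG.shimuraIter w b) _ _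

/-- Integration by parts: the sum of the two products is `δ` of `δ^a f · δ^b g`, which is orthogonal
to `φ`. -/
lemma peterssonPairing_shimuraIter_succ_mul {v : ℤ} (f : CuspForm (Gamma1 N) v)
    (g : ModularForm (Gamma1 N) w) (a b : ℕ) {u : ℤ} (hu : u = v + 2 * a + (w + 2 * b) + 2)
    (φ : CuspForm (Gamma1 N) u) :
    peterssonPairing N u φ (shimuraIter v (a + 1) f * shimuraIter w b g) =
      -peterssonPairing N u φ (shimuraIter v a f * shimuraIter w (b + 1) g) := by
  subst hu
  have hf : RSmooth f := .of_mdiff (mdiff_cuspForm f)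
  have hg : RSmooth g := .of_mdiff (mdiff_modularForm g)
  have hu : v + 2 * a + (w + 2 * b) = v + w + 2 * (a + b) := by ring
  have hu' : v + 2 * a + (w + 2 * b) + 2 = v + w + 2 * (a + (b + 1 : ℕ)) := by push_cast; ring
  have hu'' : v + 2 * a + (w + 2 * b) + 2 = v + w + 2 * ((a + 1 : ℕ) + b) := by push_cast; ring
  have hs (γ : SL(2, ℤ)) : RSmooth (⇑f ∣[v] γ) := .of_mdiff (mdiff_slash (mdiff_cuspForm f) v γ)
  have hs' (γ : SL(2, ℤ)) : RSmooth (⇑g ∣[w] γ) :=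
    .of_mdiff (mdiff_slash (mdiff_modularForm g) w γ)
  have hsm (γ : SL(2, ℤ)) : RSmooth ((shimuraIter v a f * shimuraIter w b g)
      ∣[v + 2 * a + (w + 2 * b)] γ) := by
    rw [shimuraIter_mul_slash hf hg v w a b hu]
    exact ((hs γ).shimuraIter v a).mul ((hs' γ).shimuraIter w b)
  have h0 := peterssonPairing_shimura_eq_zero φ
    (fun γ hγ ↦ shimuraIter_mul_slash_of_mem f g a b hu hγ) hsm
    (slashBounded_shimuraIter_mul f g a b hu).isBoundedAtImInfty_slash (fun γ ↦ by
      rw [← shimura_slash ((hf.shimuraIter v a).mul (hg.shimuraIter w b)),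
        shimura_shimuraIter_mul hf hg]
      exact ((slashBounded_shimuraIter_mul f g (a + 1) b hu'').add
        (slashBounded_shimuraIter_mul f g a (b + 1) hu')).isBoundedAtImInfty_slash γ)
  rw [shimura_shimuraIter_mul hf hg, peterssonPairing_add φ
    (slashBounded_shimuraIter_mul f g (a + 1) b hu'')
    (slashBounded_shimuraIter_mul f g a (b + 1) hu')] at h0
  exact eq_neg_of_add_eq_zero_left h0

lemma peterssonPairing_shimuraIter_mul {v : ℤ} (f : CuspForm (Gamma1 N) v)
    (g : ModularForm (Gamma1 N) w) (a b : ℕ) {u : ℤ} (hu : u = v + w + 2 * (a + b))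
    (φ : CuspForm (Gamma1 N) u) :
    peterssonPairing N u φ (shimuraIter v a f * shimuraIter w b g) =
      (-1) ^ a * peterssonPairing N u φ (f * shimuraIter w (a + b) g) := by
  induction a generalizing b with
  | zero => simp [shimuraIter]
  | succ a ih =>
    rw [peterssonPairing_shimuraIter_succ_mul f g a b (by rw [hu]; push_cast; ring),
      ih (b + 1) (by rw [hu]; push_cast; ring), pow_succ, show a + (b + 1) = a + 1 + b by ring]
    ring

/-- The two signs `(-1)^a` cancel, and the rest is Vandermonde's convolution. -/
lemma sum_neg_one_pow_mul_rankinCohenCoeff (p q m : ℕ) :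
    ∑ ab ∈ Finset.HasAntidiagonal.antidiagonal m, rankinCohenCoeff p q m ab.1 ab.2 * (-1) ^ ab.1 =
      ((p + q + 2 * m).choose m : ℂ) := by
  rw [show p + q + 2 * m = (q + m) + (p + m) by ring, Nat.add_choose_eq]
  push_cast
  refine Finset.sum_congr rfl fun ab _ ↦ ?_
  have h : ((-1 : ℂ) ^ ab.1) * (-1) ^ ab.1 = 1 := by rw [← mul_pow]; simp
  rw [rankinCohenCoeff]
  push_cast
  linear_combination ((p + m).choose ab.2 : ℂ) * (q + m).choose ab.1 * h

variable {v u : ℤ} {p q : ℕ} (m : ℕ)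

/-- In its Maass-Shimura form the bracket is a sum of terms each of which can be moved to a multiple
of `f · δ^m g` by parts. -/
lemma peterssonPairing_rankinCohen (f : CuspForm (Gamma1 N) v) (g : ModularForm (Gamma1 N) w)
    (hv : v = p + 1) (hw : w = q + 1) (hu : u = v + w + 2 * m) (φ : CuspForm (Gamma1 N) u) :
    peterssonPairing N u φ (rankinCohen p q m f g) =
      ((p + q + 2 * m).choose m : ℂ) * peterssonPairing N u φ (f * shimuraIter w m g) := by
  have hab {ab : ℕ × ℕ} (h : ab ∈ Finset.HasAntidiagonal.antidiagonal m) :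
      u = v + w + 2 * (ab.1 + ab.2) := by
    rw [hu, ← Finset.HasAntidiagonal.mem_antidiagonal.mp h]
    push_cast
    ring
  rw [rankinCohen_eq_shimura p q m (mdiff_cuspForm f) (mdiff_modularForm g), ← hv, ← hw,
    peterssonPairing_sum φ _
    fun ab h ↦ (slashBounded_shimuraIter_mul f g ab.1 ab.2 (hab h)).const_smul _,
    ← sum_neg_one_pow_mul_rankinCohenCoeff, Finset.sum_mul]
  refine Finset.sum_congr rfl fun ab h ↦ ?_
  rw [peterssonPairing_smul, peterssonPairing_shimuraIter_mul f g ab.1 ab.2 (hab h),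
    Finset.HasAntidiagonal.mem_antidiagonal.mp h]
  ring

/-- The Rankin-Cohen bracket of a cusp form and a modular form, as a cusp form. -/
def rankinCohenCuspForm (f : CuspForm (Gamma1 N) v) (g : ModularForm (Gamma1 N) w)
    (hv : v = p + 1) (hw : w = q + 1) (hu : u = v + w + 2 * m) : CuspForm (Gamma1 N) u where
  toFun := rankinCohen p q m f g
  slash_action_eq' γ hγ := by
    obtain ⟨γ, hγ, rfl⟩ := hγ
    have h1 : ⇑f ∣[v] γ = f := f.slash_action_eq' _ ⟨γ, hγ, rfl⟩
    have h2 : ⇑g ∣[w] γ = g := g.slash_action_eq' _ ⟨γ, hγ, rfl⟩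
    have h := rankinCohen_slash p q m (mdiff_cuspForm f) (mdiff_modularForm g) (u := u)
      (by rw [hu, hv, hw]; ring) γ
    rw [← hv, ← hw] at h
    exact h.trans (congrArg₂ _ h1 h2)
  holo' := mdiff_rankinCohen p q m (mdiff_cuspForm f) (mdiff_modularForm g)
  zero_at_cusps' {c} hc := by
    -- Every cusp is an `SL(2, ℤ)`-translate of `∞`, so vanishing of all slash translates at `i∞`
    -- suffices.
    rw [Subgroup.IsArithmetic.isCusp_iff_isCusp_SL2Z] at hc
    rw [OnePoint.isZeroAt_iff_forall_SL2Z hc]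
    intro γ _
    have h := rankinCohen_slash p q m (mdiff_cuspForm f) (mdiff_modularForm g) (u := u)
      (by rw [hu, hv, hw]; ring) γ
    rw [← hv, ← hw] at h
    refine h ▸ isZeroAtImInfty_rankinCohen p q m (mdiff_slash (mdiff_cuspForm f) v γ)
      (mdiff_slash (mdiff_modularForm g) w γ) (CuspFormClass.zero_at_infty_slash f γ)
      (ModularFormClass.bdd_at_infty_slash g γ)

theorem isHolomorphicProjection_rankinCohenCuspForm (f : CuspForm (Gamma1 N) v)
    (g : ModularForm (Gamma1 N) w) (hv : v = p + 1) (hw : w = q + 1) (hu : u = v + w + 2 * m) :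
    IsHolomorphicProjection N u (f * shimuraIter w m g)
      (((p + q + 2 * m).choose m : ℂ)⁻¹ • rankinCohenCuspForm m f g hv hw hu) where
  slash_eq γ hγ := shimuraIter_mul_slash_of_mem f g 0 m (by rw [hu]; push_cast; ring) hγ
  integrable φ γ := by
    have hb : SlashBounded u (f * shimuraIter w m g) :=
      slashBounded_shimuraIter_mul f g 0 m (by rw [hu]; push_cast; ring)
    exact (hb.integrableOn φ γ).congr_fun (fun τ _ ↦ petersson_slash_SL _ _ _ _ _)
      measurableSet_fd
  pairing_eq φ := by
    have hc : ((p + q + 2 * m).choose m : ℂ) ≠ 0 := by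
      exact_mod_cast (Nat.choose_pos (by omega)).ne'
    have h := peterssonPairing_rankinCohen m f g hv hw hu φ
    change peterssonPairing N u φ (((p + q + 2 * m).choose m : ℂ)⁻¹ • rankinCohen p q m f g) = _
    rw [peterssonPairing_smul, h, inv_mul_cancel_left₀ hc]

lemma hasQExpansion_modularForm (g : ModularForm (Gamma1 N) w) : HasQExpansion g where
  periodic := SlashInvariantFormClass.periodic_comp_ofComplex g (by simp)
  mdiff := mdiff_modularForm g
  bounded := by simpa using ModularFormClass.bdd_at_infty_slash g (1 : SL(2, ℤ))

lemma hasQExpansion_cuspForm (f : CuspForm (Gamma1 N) w) : HasQExpansion f where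
  periodic := SlashInvariantFormClass.periodic_comp_ofComplex f (by simp)
  mdiff := mdiff_cuspForm f
  bounded := by
    simpa using (CuspFormClass.zero_at_infty_slash f (1 : SL(2, ℤ))).isBoundedAtImInfty

end

end HolProj

end

/-! ### The main theorem -/

theorem proposition3p3 (N : ℕ) [NeZero N] (k r : ℕ) (hkr : k < r)
    (f : CuspForm (CongruenceSubgroup.Gamma1 N) (2 * (k : ℤ) + 1))
    (g : ModularForm (CongruenceSubgroup.Gamma1 N) 1) :
    (∃! h : CuspForm (CongruenceSubgroup.Gamma1 N) (2 * (r : ℤ)),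
      HolProj.IsHolomorphicProjection N (2 * (r : ℤ))
        (⇑f * HolProj.shimuraIter 1 (r - k - 1) ⇑g) h) ∧
    ∀ h : CuspForm (CongruenceSubgroup.Gamma1 N) (2 * (r : ℤ)),
      HolProj.IsHolomorphicProjection N (2 * (r : ℤ))
        (⇑f * HolProj.shimuraIter 1 (r - k - 1) ⇑g) h →
      (UpperHalfPlane.qExpansion 1 h).coeff 0 = 0 ∧
      (∀ n : ℕ, 1 ≤ n →
        (UpperHalfPlane.qExpansion 1 h).coeff n =
          (-1 : ℂ) ^ (r - k - 1) / (Nat.choose (2 * r - 2) (r - k - 1) : ℂ) *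
            (n : ℂ) ^ (r - k - 1) *
            ∑ p ∈ Finset.HasAntidiagonal.antidiagonal n,
              (UpperHalfPlane.qExpansion 1 f).coeff p.1 *
                (UpperHalfPlane.qExpansion 1 g).coeff p.2 *
                (HolProj.jacobiH (r - k - 1) k
                  (((p.1 : ℝ) - (p.2 : ℝ)) / ((p.1 : ℝ) + (p.2 : ℝ))) : ℂ)) ∧
      (∀ χ ψ : DirichletCharacter ℂ N,
        HolProj.HasNebentypus N (2 * (k : ℤ) + 1) χ f → HolProj.HasNebentypus N 1 ψ g →
          HolProj.HasNebentypus N (2 * (r : ℤ)) (χ * ψ) h) := by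
  obtain ⟨m, rfl⟩ : ∃ m, r = k + m + 1 := ⟨r - k - 1, by omega⟩
  -- The bracket is used with `p = 2k` and `q = 0`, so `2r - 2` appears as `p + q + 2m`.
  rw [show k + m + 1 - k - 1 = m by omega, show 2 * (k + m + 1) - 2 = 2 * k + 0 + 2 * m by omega]
  have hv : 2 * (k : ℤ) + 1 = (2 * k : ℕ) + 1 := by push_cast; ring
  have hw : (1 : ℤ) = (0 : ℕ) + 1 := by simp
  have hu : 2 * ((k + m + 1 : ℕ) : ℤ) = 2 * (k : ℤ) + 1 + 1 + 2 * m := by push_cast; ring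
  have hproj := HolProj.isHolomorphicProjection_rankinCohenCuspForm m f g hv hw hu
  have huniq : ∀ h, HolProj.IsHolomorphicProjection N _ (⇑f * HolProj.shimuraIter 1 m ⇑g) h →
      h = _ := fun h hh ↦ HolProj.cuspForm_ext_of_peterssonPairing fun φ ↦
    (hh.pairing_eq φ).trans (hproj.pairing_eq φ).symm
  refine ⟨⟨_, hproj, huniq⟩, fun h hh ↦ ?_⟩
  have hcoe : ⇑h = (((2 * k + 0 + 2 * m).choose m : ℕ) : ℂ)⁻¹ •
      HolProj.rankinCohen (2 * k) 0 m f g := congrArg DFunLike.coe (huniq h hh)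
  refine ⟨CuspFormClass.qExpansion_coeff_zero h one_pos (by simp), fun n hn ↦ ?_,
    fun χ ψ hf hg γ hγ ↦ ?_⟩
  · have hsum (τ : UpperHalfPlane) := ((HolProj.hasQExpansion_cuspForm f).hasSum_rankinCohen
      (HolProj.hasQExpansion_modularForm g) (2 * k) 0 m τ).const_smul
        (((2 * k + 0 + 2 * m).choose m : ℕ) : ℂ)⁻¹
    simp only [← smul_assoc] at hsum
    rw [← ModularFormClass.qExpansion_coeff_unique (f := h) (Γ := CongruenceSubgroup.Gamma1 N)
      (k := 2 * ((k + m + 1 : ℕ) : ℤ)) one_pos (by simp)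
      (fun τ ↦ by rw [hcoe]; exact hsum τ) n, smul_eq_mul, Finset.mul_sum, Finset.mul_sum]
    refine Finset.sum_congr rfl fun ij hij ↦ ?_
    have hn' : ij.1 + ij.2 = n := Finset.HasAntidiagonal.mem_antidiagonal.mp hij
    -- Here `n ≥ 1` ensures `i + j ≠ 0`.
    rw [HolProj.sum_rankinCohenCoeff_eq_jacobiH m k (by omega), hn']
    ring
  · rw [hcoe, ModularForm.SL_smul_slash,
      HolProj.hasNebentypus_rankinCohen m f g hv hw hu hf hg γ hγ, smul_comm]
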